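/- **Setting.** Let $\mathcal L$ be the three-sorted Denef–Pas language (sorts $\mathrm{VF}$, $\mathrm{RF}$, $\mathrm{VG}$; ring language on $\mathrm{VF}$ and on $\mathrm{RF}$, language of ordered groups with $1$ on $\mathrm{VG}$, valuation $\mathrm{ord}$ and angular component $\overline{\mathrm{ac}}$), expanded by any constant symbols, and let $\mathcal S$ be any class of $\mathcal L$-structures whose reducts are of the form $(k((t)),k,\mathbb Z)$ with $k$ a field of characteristic $0$. An $\mathcal S$-definable set $X\subset \mathrm{VF}^m\times\mathrm{RF}^n\times\mathrm{VG}^l$ is a family $(X_K)_{K\in\mathcal S}$ defined by one $\mathcal L$-formula; a point on $X$ is a pair $(K,x)$ with $K\in\mathcal S$, $x\in X_K$. Let $\mathbb A=\mathbb Z[\mathbb L,\mathbb L^{-1},(1/(1-\mathbb L^{-i}))_{i>0}]$, and let $\mathcal P(X)$ be the ring of functions from the points on $X$ to $\mathbb A$ generated by the constants, the definable functions $\alpha:X\to\mathrm{VG}$ and the functions $\mathbb L^{\beta}$ for definable $\beta:X\to \mathrm{VG}$; let $\mathcal P^0(X)$ be the subring generated by $\mathbb L$ and the characteristic functions of definable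 subsets. Let $\mathcal C^{\square}(X)$ be one of the two rings of motivic functions $\mathcal C(X)=\mathcal P(X)\otimes_{\mathcal P^0(X)}K_0(\mathrm{RDef}_X)$ and $\mathcal C^{\exp}(X)=\mathcal P(X)\otimes_{\mathcal P^0(X)}K_0(\mathrm{RDef}^{\exp}_X)$ of Cluckers and Loeser. (Here $K_0(\mathrm{RDef}_X)$ is the Grothendieck ring of definable sets $Y\subset X\times\mathrm{RF}^n$ over $X$. The ring $K_0(\mathrm{RDef}_X^{\exp})$ is generated by classes $[Y,\xi,g]$ with $Y$ as before and $\xi:Y\to\mathrm{RF}$, $g:Y\to\mathrm{VF}$ definable, subject to isomorphism over $X$, $[\emptyset,\xi,g]=0$, additivity for unions, $[Y,\xi,g+h]=[Y,\xi+\bar h,g]$ whenever $\mathrm{ord}\,h\ge 0$, with $\bar h$ the residue of $h$, and $[Y\times\mathrm{RF},\xi+\mathrm{pr}_{\mathrm{RF}},g]=0$, with product given by fibre products and addition of the $\xi$ and of the $g$. The map from $\mathcal P^0(X)$ sends $1_Z$ to $[Z]$ and $\mathbb L$ to $[X\times\mathrm{RF}]$.) **Statement.** Let $A$ be an $\mathcal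 S$-definable set, $r\ge 0$, $L\subset\mathbb N^r\times\mathbb Z^r$ finite, $c_{a,b}\in\mathcal C^{\square}(A)$ for $(a,b)\in L$, let $g=(g_1,\dots,g_r)$ be the coordinate projection $\mathrm{VG}_{\ge 0}^r\times A\to\mathrm{VG}_{\ge0}^r$, and let $$f=\sum_{(a,b)\in L}c_{a,b}\cdot g^a\cdot\mathbb L^{b\cdot g}\in\mathcal C^{\square}(\mathrm{VG}_{\ge 0}^r\times A),$$ where $c_{a,b}$ is pulled back along $\mathrm{VG}_{\ge 0}^r\times A\to A$, $g^a=g_1^{a_1}\cdots g_r^{a_r}$ and $b\cdot g=b_1g_1+\dots+b_rg_r$. 1. If for every $x\in\mathbb N^r$ the restriction of $f$ to the $\mathcal S$-definable set $\{x\}\times A$ is zero in $\mathcal C^{\square}(\{x\}\times A)$, then $f=0$ in $\mathcal C^{\square}(\mathrm{VG}_{\ge0}^r\times A)$. 2. For a point $(K,x)$ on $\mathrm{VG}_{\ge0}^r$, let $\mathcal S(K,x)$ be the class of all pairs $(K',x')$ with $K'\in\mathcal S$ and $(K',x')$ elementarily equivalent to $(K,x)$. If for every point $(K,x)$ on $\mathrm{VG}_{\ge0}^r$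 the restriction of $f$ to $\{x\}\times A$, considered over $\mathcal S(K,x)$, is zero, then for every $K\in\mathcal S$ the motivic function $f$ is zero over the class of all structures in $\mathcal S$ that are elementarily equivalent to $K$. In particular $f=0$ in $\mathcal C^{\square}(\mathrm{VG}_{\ge0}^r\times A)$ if all structures in $\mathcal S$ are elementarily equivalent. -/

import Mathlib

universe u v w

noncomputable section

open scoped TensorProduct

namespace Motivic

/-! ### The three-sorted language of Denef and Pas, expanded by constant symbols -/

/-- A triple of types, one for each of the sorts `VF` (valued field), `RF` (residue field) and
`VG` (value group). It is used for families of constant symbols and for families of variables. -/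
structure Sorts : Type (v + 1) where
  vf : Type v
  rf : Type v
  vg : Type v

/-- The variables of the ambient space `VF^m × RF^n × VG^l`. -/
abbrev ambient (m n l : ℕ) : Sorts.{0} := ⟨Fin m, Fin n, Fin l⟩

/-- Disjoint union of two families of variables (product of the two ambient spaces). -/
abbrev Sorts.prod (V W : Sorts.{0}) : Sorts.{0} :=
  ⟨V.vf ⊕ W.vf, V.rf ⊕ W.rf, V.vg ⊕ W.vg⟩

/-- Values in `(k((t)), k, ℤ)` for a family of symbols. For `V = ambient m n l` this is the set
`k((t))^m × k^n × ℤ^l`. -/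
@[ext] structure Assign (k : Type u) [Field k] (V : Sorts.{w}) where
  vf : V.vf → LaurentSeries k
  rf : V.rf → k
  vg : V.vg → ℤ

/-- Concatenation of tuples. -/
def Assign.append {k : Type u} [Field k] {V W : Sorts.{0}} (x : Assign k V) (y : Assign k W) :
    Assign k (V.prod W) :=
  ⟨Sum.elim x.vf y.vf, Sum.elim x.rf y.rf, Sum.elim x.vg y.vg⟩

/-- First part of a concatenated tuple. -/
def Assign.fst {k : Type u} [Field k] {V W : Sorts.{0}} (x : Assign k (V.prod W)) : Assign k V :=
  ⟨fun i => x.vf (Sum.inl i), fun i => x.rf (Sum.inl i), fun i => x.vg (Sum.inl i)⟩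

/-- Second part of a concatenated tuple. -/
def Assign.snd {k : Type u} [Field k] {V W : Sorts.{0}} (x : Assign k (V.prod W)) : Assign k W :=
  ⟨fun i => x.vf (Sum.inr i), fun i => x.rf (Sum.inr i), fun i => x.vg (Sum.inr i)⟩

/-- The empty tuple. -/
def Assign.empty (k : Type u) [Field k] : Assign k (ambient 0 0 0) :=
  ⟨Fin.elim0, Fin.elim0, Fin.elim0⟩

/-- An element of `k((t))` as a tuple. -/
def vfPt {k : Type u} [Field k] (z : LaurentSeries k) : Assign k (ambient 1 0 0) :=
  ⟨fun _ => z, Fin.elim0, Fin.elim0⟩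

/-- An element of `k^n` as a tuple. -/
def rfPt {k : Type u} [Field k] {n : ℕ} (y : Fin n → k) : Assign k (ambient 0 n 0) :=
  ⟨Fin.elim0, y, Fin.elim0⟩

/-- An element of `ℤ^r` as a tuple. -/
def vgPt {k : Type u} [Field k] {r : ℕ} (a : Fin r → ℤ) : Assign k (ambient 0 0 r) :=
  ⟨Fin.elim0, Fin.elim0, a⟩

/-- A structure `(k((t)), k, ℤ)`, with `k` a field of characteristic zero, together with an
interpretation of the constant symbols `C`. -/
structure DPModel (C : Sorts.{v}) where
  k : Type u
  [field : Field k]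
  [charZero : CharZero k]
  const : Assign k C

attribute [instance] DPModel.field DPModel.charZero

section Terms

variable (C : Sorts.{v}) (V : Sorts.{0})

/-- Terms of sort `VF`: the language of rings, with constants. -/
inductive VFTerm : Type v
  | var (i : V.vf)
  | const (c : C.vf)
  | zero
  | one
  | neg (s : VFTerm)
  | add (s t : VFTerm)
  | mul (s t : VFTerm)

/-- Terms of sort `RF`: the language of rings, with constants, and the angular component. -/
inductive RFTerm : Type v
  | var (i : V.rf)
  | const (c : C.rf)
  | zero
  | one
  | neg (s : RFTerm)
  | add (s t : RFTerm)
  | mul (s t : RFTerm)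
  | ac (s : VFTerm C V)

/-- Terms of sort `VG`: the language of ordered groups with `1`, with constants, and the valuation.
(Congruences modulo positive integers are definable from these.) -/
inductive VGTerm : Type v
  | var (i : V.vg)
  | const (c : C.vg)
  | zero
  | one
  | neg (s : VGTerm)
  | add (s t : VGTerm)
  | ord (s : VFTerm C V)

end Terms

/-- First-order formulas with free variables in `V`. A quantifier binds one additional variable
of the sort in question. -/
inductive Formula (C : Sorts.{v}) : Sorts.{0} → Type (max 1 v)
  | eqVF {V : Sorts.{0}} (s t : VFTerm C V) : Formula C V
  | eqRF {V : Sorts.{0}} (s t : RFTerm C V) : Formula C V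
  | eqVG {V : Sorts.{0}} (s t : VGTerm C V) : Formula C V
  | leVG {V : Sorts.{0}} (s t : VGTerm C V) : Formula C V
  | not {V : Sorts.{0}} (φ : Formula C V) : Formula C V
  | and {V : Sorts.{0}} (φ ψ : Formula C V) : Formula C V
  | exVF {V : Sorts.{0}} (φ : Formula C (V.prod (ambient 1 0 0))) : Formula C V
  | exRF {V : Sorts.{0}} (φ : Formula C (V.prod (ambient 0 1 0))) : Formula C V
  | exVG {V : Sorts.{0}} (φ : Formula C (V.prod (ambient 0 0 1))) : Formula C V

section Semantics

variable {C : Sorts.{v}}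

def VFTerm.eval {V : Sorts.{0}} (K : DPModel.{u} C) (x : Assign K.k V) :
    VFTerm C V → LaurentSeries K.k
  | .var i => x.vf i
  | .const c => K.const.vf c
  | .zero => 0
  | .one => 1
  | .neg s => -(s.eval K x)
  | .add s t => s.eval K x + t.eval K x
  | .mul s t => s.eval K x * t.eval K x

/-- The angular component of a non-zero series is its leading coefficient, and `ac 0 = 0`. -/
def RFTerm.eval {V : Sorts.{0}} (K : DPModel.{u} C) (x : Assign K.k V) : RFTerm C V → K.k
  | .var i => x.rf i
  | .const c => K.const.rf c
  | .zero => 0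
  | .one => 1
  | .neg s => -(s.eval K x)
  | .add s t => s.eval K x + t.eval K x
  | .mul s t => s.eval K x * t.eval K x
  | .ac s => (s.eval K x).leadingCoeff

/-- `ord` is the `t`-adic order. Its value at `0` is set to `0`; since `{0}` is definable, this
convention has no influence on which sets are definable. -/
def VGTerm.eval {V : Sorts.{0}} (K : DPModel.{u} C) (x : Assign K.k V) : VGTerm C V → ℤ
  | .var i => x.vg i
  | .const c => K.const.vg c
  | .zero => 0
  | .one => 1
  | .neg s => -(s.eval K x)
  | .add s t => s.eval K x + t.eval K x
  | .ord s => (s.eval K x).order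

/-- Satisfaction of a formula in a structure `(k((t)), k, ℤ)`. -/
def Formula.Realize (K : DPModel.{u} C) : {V : Sorts.{0}} → Formula C V → Assign K.k V → Prop
  | _, .eqVF s t, x => s.eval K x = t.eval K x
  | _, .eqRF s t, x => s.eval K x = t.eval K x
  | _, .eqVG s t, x => s.eval K x = t.eval K x
  | _, .leVG s t, x => s.eval K x ≤ t.eval K x
  | _, .not φ, x => ¬ φ.Realize K x
  | _, .and φ ψ, x => φ.Realize K x ∧ ψ.Realize K x
  | _, .exVF φ, x => ∃ z : LaurentSeries K.k, φ.Realize K (x.append (vfPt z))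
  | _, .exRF φ, x => ∃ z : K.k, φ.Realize K (x.append (rfPt fun _ => z))
  | _, .exVG φ, x => ∃ z : ℤ, φ.Realize K (x.append (vgPt fun _ => z))

/-- Two structures are elementarily equivalent. -/
def ElemEquiv (K K' : DPModel.{u} C) : Prop :=
  ∀ φ : Formula C (ambient 0 0 0),
    φ.Realize K (Assign.empty K.k) ↔ φ.Realize K' (Assign.empty K'.k)

end Semantics

/-! ### Renaming of variables -/

/-- A map of families of variables. -/
structure Ren (V W : Sorts.{0}) where
  vf : V.vf → W.vf
  rf : V.rf → W.rf
  vg : V.vg → W.vg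

def Ren.lift {V W : Sorts.{0}} (ρ : Ren V W) (U : Sorts.{0}) : Ren (V.prod U) (W.prod U) :=
  ⟨Sum.map ρ.vf id, Sum.map ρ.rf id, Sum.map ρ.vg id⟩

def Assign.comp {k : Type u} [Field k] {V W : Sorts.{0}} (x : Assign k W) (ρ : Ren V W) :
    Assign k V :=
  ⟨x.vf ∘ ρ.vf, x.rf ∘ ρ.rf, x.vg ∘ ρ.vg⟩

theorem Assign.append_comp_lift {k : Type u} [Field k] {V W U : Sorts.{0}} (ρ : Ren V W)
    (x : Assign k W) (y : Assign k U) :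
    (x.append y).comp (ρ.lift U) = (x.comp ρ).append y := by
  ext i <;> rcases i with i | i <;> rfl

section Rename

variable {C : Sorts.{v}}

def VFTerm.rename {V W : Sorts.{0}} (ρ : Ren V W) : VFTerm C V → VFTerm C W
  | .var i => .var (ρ.vf i)
  | .const c => .const c
  | .zero => .zero
  | .one => .one
  | .neg s => .neg (s.rename ρ)
  | .add s t => .add (s.rename ρ) (t.rename ρ)
  | .mul s t => .mul (s.rename ρ) (t.rename ρ)

def RFTerm.rename {V W : Sorts.{0}} (ρ : Ren V W) : RFTerm C V → RFTerm C W
  | .var i => .var (ρ.rf i)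
  | .const c => .const c
  | .zero => .zero
  | .one => .one
  | .neg s => .neg (s.rename ρ)
  | .add s t => .add (s.rename ρ) (t.rename ρ)
  | .mul s t => .mul (s.rename ρ) (t.rename ρ)
  | .ac s => .ac (s.rename ρ)

def VGTerm.rename {V W : Sorts.{0}} (ρ : Ren V W) : VGTerm C V → VGTerm C W
  | .var i => .var (ρ.vg i)
  | .const c => .const c
  | .zero => .zero
  | .one => .one
  | .neg s => .neg (s.rename ρ)
  | .add s t => .add (s.rename ρ) (t.rename ρ)
  | .ord s => .ord (s.rename ρ)

def Formula.rename : {V W : Sorts.{0}} → Ren V W → Formula C V → Formula C W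
  | _, _, ρ, .eqVF s t => .eqVF (s.rename ρ) (t.rename ρ)
  | _, _, ρ, .eqRF s t => .eqRF (s.rename ρ) (t.rename ρ)
  | _, _, ρ, .eqVG s t => .eqVG (s.rename ρ) (t.rename ρ)
  | _, _, ρ, .leVG s t => .leVG (s.rename ρ) (t.rename ρ)
  | _, _, ρ, .not φ => .not (φ.rename ρ)
  | _, _, ρ, .and φ ψ => .and (φ.rename ρ) (ψ.rename ρ)
  | _, _, ρ, .exVF φ => .exVF (φ.rename (ρ.lift _))
  | _, _, ρ, .exRF φ => .exRF (φ.rename (ρ.lift _))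
  | _, _, ρ, .exVG φ => .exVG (φ.rename (ρ.lift _))

theorem VFTerm.eval_rename {V W : Sorts.{0}} (ρ : Ren V W) (K : DPModel.{u} C) (x : Assign K.k W)
    (s : VFTerm C V) : (s.rename ρ).eval K x = s.eval K (x.comp ρ) := by
  induction s <;> simp_all [VFTerm.rename, VFTerm.eval, Assign.comp]

theorem RFTerm.eval_rename {V W : Sorts.{0}} (ρ : Ren V W) (K : DPModel.{u} C) (x : Assign K.k W)
    (s : RFTerm C V) : (s.rename ρ).eval K x = s.eval K (x.comp ρ) := by
  induction s with
  | ac s => simp [RFTerm.rename, RFTerm.eval, VFTerm.eval_rename]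
  | _ => simp_all [RFTerm.rename, RFTerm.eval, Assign.comp]

theorem VGTerm.eval_rename {V W : Sorts.{0}} (ρ : Ren V W) (K : DPModel.{u} C) (x : Assign K.k W)
    (s : VGTerm C V) : (s.rename ρ).eval K x = s.eval K (x.comp ρ) := by
  induction s with
  | ord s => simp [VGTerm.rename, VGTerm.eval, VFTerm.eval_rename]
  | _ => simp_all [VGTerm.rename, VGTerm.eval, Assign.comp]

theorem Formula.realize_rename {V W : Sorts.{0}} (ρ : Ren V W) (K : DPModel.{u} C)
    (x : Assign K.k W) (φ : Formula C V) :
    (φ.rename ρ).Realize K x ↔ φ.Realize K (x.comp ρ) := by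
  induction φ generalizing W with
  | eqVF s t => simp [Formula.rename, Formula.Realize, VFTerm.eval_rename]
  | eqRF s t => simp [Formula.rename, Formula.Realize, RFTerm.eval_rename]
  | eqVG s t => simp [Formula.rename, Formula.Realize, VGTerm.eval_rename]
  | leVG s t => simp [Formula.rename, Formula.Realize, VGTerm.eval_rename]
  | not φ ih => simp [Formula.rename, Formula.Realize, ih]
  | and φ ψ ih₁ ih₂ => simp [Formula.rename, Formula.Realize, ih₁, ih₂]
  | exVF φ ih => simp [Formula.rename, Formula.Realize, ih, Assign.append_comp_lift]
  | exRF φ ih => simp [Formula.rename, Formula.Realize, ih, Assign.append_comp_lift]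
  | exVG φ ih => simp [Formula.rename, Formula.Realize, ih, Assign.append_comp_lift]

end Rename

/-! ### Points, definable sets, definable functions -/

section Points

variable {C : Sorts.{v}}

/-- A point of the ambient space with variables `V`: a structure `K` and a tuple in `K`. -/
structure Point (C : Sorts.{v}) (V : Sorts.{0}) where
  K : DPModel.{u} C
  x : Assign K.k V

/-- First coordinate of a point of a product. -/
def Point.fst {V W : Sorts.{0}} (p : Point.{u} C (V.prod W)) : Point.{u} C V := ⟨p.K, p.x.fst⟩

/-- Second coordinate of a point of a product. -/
def Point.snd {V W : Sorts.{0}} (p : Point.{u} C (V.prod W)) : Point.{u} C W := ⟨p.K, p.x.snd⟩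

/-- Two points `(K, x)` and `(K', x')` satisfy the same formulas, i.e. the expansions of `K` and
`K'` by constants for `x` and `x'` are elementarily equivalent. -/
def SameType {V : Sorts.{0}} (p q : Point.{u} C V) : Prop :=
  ∀ φ : Formula C V, φ.Realize p.K p.x ↔ φ.Realize q.K q.x

/-- `A` is (the set of points of) an `S`-definable set: `A_K` is defined by one formula, uniformly
for all `K` in the class `S`. -/
def IsDefinable (S : Set (DPModel.{u} C)) {V : Sorts.{0}} (A : Set (Point.{u} C V)) : Prop :=
  ∃ φ : Formula C V, A = {p | p.K ∈ S ∧ φ.Realize p.K p.x}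

variable {V : Sorts.{0}} (B : Set (Point.{u} C V))

/-- A definable subset `Z ⊆ B × RF^n`, given through its fibres over the points of `B`. -/
def DefSet {n : ℕ} (Z : ∀ p : B, Set (Fin n → p.1.K.k)) : Prop :=
  ∃ φ : Formula C (V.prod (ambient 0 n 0)), ∀ (p : B) (y : Fin n → p.1.K.k),
    φ.Realize p.1.K (p.1.x.append (rfPt y)) ↔ y ∈ Z p

/-- The function `h` is a definable function over `B` from `Y ⊆ B × RF^n` to `RF^m`
(only the values of `h` on `Y` matter). -/
def DefMapRF {n m : ℕ} (Y : ∀ p : B, Set (Fin n → p.1.K.k))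
    (h : ∀ p : B, (Fin n → p.1.K.k) → (Fin m → p.1.K.k)) : Prop :=
  ∃ φ : Formula C (V.prod ⟨Fin 0, Fin n ⊕ Fin m, Fin 0⟩),
    ∀ (p : B), ∀ y ∈ Y p, ∀ z : Fin m → p.1.K.k,
      φ.Realize p.1.K (p.1.x.append ⟨Fin.elim0, Sum.elim y z, Fin.elim0⟩) ↔ h p y = z

/-- The function `g` is a definable function from `Y ⊆ B × RF^n` to `VF`
(only the values of `g` on `Y` matter). -/
def DefMapVF {n : ℕ} (Y : ∀ p : B, Set (Fin n → p.1.K.k))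
    (g : ∀ p : B, (Fin n → p.1.K.k) → LaurentSeries p.1.K.k) : Prop :=
  ∃ φ : Formula C (V.prod ⟨Fin 1, Fin n, Fin 0⟩),
    ∀ (p : B), ∀ y ∈ Y p, ∀ z : LaurentSeries p.1.K.k,
      φ.Realize p.1.K (p.1.x.append ⟨fun _ => z, y, Fin.elim0⟩) ↔ g p y = z

/-- The function `α` is a definable function from `B` to `VG`. -/
def DefFunVG (α : B → ℤ) : Prop :=
  ∃ φ : Formula C (V.prod (ambient 0 0 1)), ∀ (p : B) (z : ℤ),
    φ.Realize p.1.K (p.1.x.append (vgPt fun _ => z)) ↔ α p = z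

end Points

/-! ### The Grothendieck rings of sets in residue field variables -/

/-- The two classes of motivic functions: without exponentials (`𝒞`), and with exponentials
(`𝒞^exp`). -/
inductive Kind
  | plain
  | exp

section Grothendieck

variable {C : Sorts.{v}} {V : Sorts.{0}}

/-- A generator of the Grothendieck ring over `B`: a triple `(Y, ξ, g)` consisting of a definable
subset `Y ⊆ B × RF^n` and definable functions `ξ : Y → RF` and `g : Y → VF`. It stands for the sum
over the fibres of `Y` of `E(g) e(ξ)`. In the class without exponentials one has `ξ = 0`
and `g = 0`, so that a generator is just a definable `Y ⊆ B × RF^n`. -/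
structure Obj (e : Kind) (B : Set (Point.{u} C V)) where
  n : ℕ
  Y : ∀ p : B, Set (Fin n → p.1.K.k)
  ξ : ∀ p : B, (Fin n → p.1.K.k) → p.1.K.k
  g : ∀ p : B, (Fin n → p.1.K.k) → LaurentSeries p.1.K.k
  defY : DefSet B Y
  defξ : DefMapRF B (m := 1) Y (fun p y _ => ξ p y)
  defg : DefMapVF B Y g
  plain : e = Kind.plain → ∀ p, ∀ y ∈ Y p, ξ p y = 0 ∧ g p y = 0

variable {e : Kind} {B : Set (Point.{u} C V)}

/-- The functions `ξ` and `g` vanish on `Y`. -/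
def Obj.Trivial (a : Obj e B) : Prop := ∀ p, ∀ y ∈ a.Y p, a.ξ p y = 0 ∧ a.g p y = 0

/-- The restriction of `(Y, ξ, g)` to `Y ∩ Z`, for a definable `Z ⊆ B × RF^n`. -/
def Obj.sub (a : Obj e B) (Z : ∀ p : B, Set (Fin a.n → p.1.K.k)) (hZ : DefSet B Z) :
    Obj e B where
  n := a.n
  Y := fun p => a.Y p ∩ Z p
  ξ := a.ξ
  g := a.g
  defY := by
    obtain ⟨φ, hφ⟩ := a.defY
    obtain ⟨ψ, hψ⟩ := hZ
    exact ⟨φ.and ψ, fun p y => and_congr (hφ p y) (hψ p y)⟩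
  defξ := by
    obtain ⟨φ, hφ⟩ := a.defξ
    exact ⟨φ, fun p y hy z => hφ p y hy.1 z⟩
  defg := by
    obtain ⟨φ, hφ⟩ := a.defg
    exact ⟨φ, fun p y hy z => hφ p y hy.1 z⟩
  plain := fun h p y hy => a.plain h p y hy.1

theorem DefSet.union {n : ℕ} {Z Z' : ∀ p : B, Set (Fin n → p.1.K.k)} (hZ : DefSet B Z)
    (hZ' : DefSet B Z') : DefSet B (fun p => Z p ∪ Z' p) := by
  obtain ⟨φ, hφ⟩ := hZ
  obtain ⟨ψ, hψ⟩ := hZ'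
  refine ⟨(φ.not.and ψ.not).not, fun p y => ?_⟩
  simp only [Formula.Realize, hφ, hψ, Set.mem_union]
  tauto

theorem DefSet.inter {n : ℕ} {Z Z' : ∀ p : B, Set (Fin n → p.1.K.k)} (hZ : DefSet B Z)
    (hZ' : DefSet B Z') : DefSet B (fun p => Z p ∩ Z' p) := by
  obtain ⟨φ, hφ⟩ := hZ
  obtain ⟨ψ, hψ⟩ := hZ'
  exact ⟨φ.and ψ, fun p y => and_congr (hφ p y) (hψ p y)⟩

/-- `h` is a definable bijection `a.Y → b.Y` over `B`. -/
def IsDefBij (a b : Obj e B) (h : ∀ p : B, (Fin a.n → p.1.K.k) → (Fin b.n → p.1.K.k)) : Prop :=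
  DefMapRF B a.Y h ∧ ∀ p, Set.BijOn (h p) (a.Y p) (b.Y p)

/-- `z ∈ k((t))` lies in the valuation ring `k[[t]]`. -/
def InValRing {k : Type u} [Field k] (z : LaurentSeries k) : Prop := ∀ i : ℤ, i < 0 → z.coeff i = 0

/-- The relations of the Grothendieck ring. -/
inductive Rel : FreeCommRing (Obj e B) → FreeCommRing (Obj e B) → Prop
  /-- Triples that are definably isomorphic over `B` have the same class. -/
  | iso (a b : Obj e B) (h : ∀ p : B, (Fin a.n → p.1.K.k) → (Fin b.n → p.1.K.k))
      (hh : IsDefBij a b h)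
      (hc : ∀ p, ∀ y ∈ a.Y p, b.ξ p (h p y) = a.ξ p y ∧ b.g p (h p y) = a.g p y) :
      Rel (.of a) (.of b)
  /-- The class of the empty set is zero. -/
  | empty (a : Obj e B) (ha : ∀ p, a.Y p = ∅) : Rel (.of a) 0
  /-- `[Z ∪ Z'] + [Z ∩ Z'] = [Z] + [Z']`. -/
  | scissor (a : Obj e B) (Z Z' : ∀ p : B, Set (Fin a.n → p.1.K.k)) (hZ : DefSet B Z)
      (hZ' : DefSet B Z') :
      Rel (.of (a.sub _ (hZ.union hZ')) + .of (a.sub _ (hZ.inter hZ')))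
        (.of (a.sub Z hZ) + .of (a.sub Z' hZ'))
  /-- `[Y, ξ, g + η] = [Y, ξ + res η, g]` if `η` takes values in the valuation ring (where `Y` may
  be replaced by an isomorphic copy). -/
  | residue (a b : Obj e B) (h : ∀ p : B, (Fin a.n → p.1.K.k) → (Fin b.n → p.1.K.k))
      (hh : IsDefBij a b h)
      (hc : ∀ p, ∀ y ∈ a.Y p, InValRing (a.g p y - b.g p (h p y)) ∧
        b.ξ p (h p y) = a.ξ p y + (a.g p y - b.g p (h p y)).coeff 0) :
      Rel (.of a) (.of b)
  /-- `[Y × RF, ξ + pr, g] = 0`, where `pr` is the projection to `RF` (and `Y × RF` may be replaced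
  by an isomorphic copy). -/
  | line (a b : Obj e B) (h : ∀ p : B, (Fin b.n → p.1.K.k) → (Fin a.n → p.1.K.k))
      (q : ∀ p : B, (Fin b.n → p.1.K.k) → p.1.K.k)
      (hh : DefMapRF B b.Y h) (hq : DefMapRF B (m := 1) b.Y (fun p y _ => q p y))
      (hb : ∀ p, Set.BijOn (fun y => (h p y, q p y)) (b.Y p) (a.Y p ×ˢ Set.univ))
      (hc : ∀ p, ∀ y ∈ b.Y p, b.ξ p y = a.ξ p (h p y) + q p y ∧ b.g p y = a.g p (h p y)) :
      Rel (.of b) 0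
  /-- `[B, 0, 0] = 1`. -/
  | unit (a : Obj e B) (hn : a.n = 0) (hY : ∀ p, a.Y p = Set.univ) (ht : a.Trivial) : Rel (.of a) 1
  /-- `[Y, ξ, g] [Y', ξ', g'] = [Y ×_B Y', ξ + ξ', g + g']`: here `c.Y` with the maps `h` and `h'`
  is a definable copy of the fibre product of `a.Y` and `b.Y`. -/
  | prod (a b c : Obj e B) (h : ∀ p : B, (Fin c.n → p.1.K.k) → (Fin a.n → p.1.K.k))
      (h' : ∀ p : B, (Fin c.n → p.1.K.k) → (Fin b.n → p.1.K.k))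
      (hh : DefMapRF B c.Y h) (hh' : DefMapRF B c.Y h')
      (hb : ∀ p, Set.BijOn (fun y => (h p y, h' p y)) (c.Y p) (a.Y p ×ˢ b.Y p))
      (hc : ∀ p, ∀ y ∈ c.Y p, c.ξ p y = a.ξ p (h p y) + b.ξ p (h' p y) ∧
        c.g p y = a.g p (h p y) + b.g p (h' p y)) :
      Rel (.of a * .of b) (.of c)

/-- The ideal of relations. -/
def relIdeal (e : Kind) (B : Set (Point.{u} C V)) : Ideal (FreeCommRing (Obj e B)) :=
  Ideal.span {z | ∃ x y, Rel x y ∧ z = x - y}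

/-- The Grothendieck ring `K₀(RDef_B)` (for `Kind.plain`), or `K₀(RDef_B^exp)` (for `Kind.exp`). -/
def K0 (e : Kind) (B : Set (Point.{u} C V)) : Type _ := FreeCommRing (Obj e B) ⧸ relIdeal e B

instance (e : Kind) (B : Set (Point.{u} C V)) : CommRing (K0 e B) :=
  inferInstanceAs (CommRing (FreeCommRing (Obj e B) ⧸ relIdeal e B))

/-- The class `[Y, ξ, g]` of a triple. -/
def Obj.cls (a : Obj e B) : K0 e B := Ideal.Quotient.mk (relIdeal e B) (FreeCommRing.of a)

end Grothendieck

/-! ### Presburger functions and motivic functions -/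

/-- The symbol `𝕃`, as an element of `ℚ(𝕃)`. -/
abbrev LL : RatFunc ℚ := RatFunc.X

/-- The ring `𝔸 = ℤ[𝕃, 𝕃⁻¹, (1 / (1 - 𝕃^{-i}))_{i > 0}]`. -/
def coeffRing : Subring (RatFunc ℚ) :=
  Subring.closure ({LL, LL⁻¹} ∪ {a | ∃ i : ℕ, 0 < i ∧ a = (1 - LL⁻¹ ^ i)⁻¹})

section MotivicFunctions

variable {C : Sorts.{v}} {V : Sorts.{0}}

/-- The ring `𝒫(B)` of Presburger functions on `B`: the subring of the ring of functions from the
points of `B` to `𝔸` that is generated by the constants, by the definable functions `α : B → VG`,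
and by the functions `𝕃^β` for definable functions `β : B → VG`. -/
def PFun (B : Set (Point.{u} C V)) : Subring (B → RatFunc ℚ) :=
  Subring.closure
    ({F | ∃ a ∈ coeffRing, F = fun _ => a} ∪
      {F | ∃ α : B → ℤ, DefFunVG B α ∧ F = fun p => (α p : RatFunc ℚ)} ∪
      {F | ∃ β : B → ℤ, DefFunVG B β ∧ F = fun p => LL ^ β p})

open Classical in
/-- The identifications made in `𝒫(B) ⊗ K₀`, where the tensor product over `ℤ` is turned into
the tensor product over the ring `𝒫⁰(B)` generated by `𝕃` and the characteristic functions of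
definable subsets: `1_Z` is identified with the class of `Z ⊆ B`, and `𝕃` with the class of
`B × RF`. -/
def amalgIdeal (e : Kind) (B : Set (Point.{u} C V)) : Ideal (PFun B ⊗[ℤ] K0 e B) :=
  Ideal.span
    ({z | ∃ (a : Obj e B) (F : PFun B), a.n = 0 ∧ a.Trivial ∧
        (∀ p, F.1 p = if (a.Y p).Nonempty then 1 else 0) ∧
        z = F ⊗ₜ[ℤ] 1 - 1 ⊗ₜ[ℤ] a.cls} ∪
      {z | ∃ (a : Obj e B) (F : PFun B), a.n = 1 ∧ a.Trivial ∧ (∀ p, a.Y p = Set.univ) ∧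
        (∀ p, F.1 p = LL) ∧
        z = F ⊗ₜ[ℤ] 1 - 1 ⊗ₜ[ℤ] a.cls})

/-- The ring of motivic functions on `B`: `𝒞(B) = 𝒫(B) ⊗_{𝒫⁰(B)} K₀(RDef_B)` for `Kind.plain`, and
`𝒞^exp(B) = 𝒫(B) ⊗_{𝒫⁰(B)} K₀(RDef_B^exp)` for `Kind.exp`. -/
def MotFun (e : Kind) (B : Set (Point.{u} C V)) : Type _ :=
  (PFun B ⊗[ℤ] K0 e B) ⧸ amalgIdeal e B

instance (e : Kind) (B : Set (Point.{u} C V)) : CommRing (MotFun e B) :=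
  inferInstanceAs (CommRing ((PFun B ⊗[ℤ] K0 e B) ⧸ amalgIdeal e B))

/-- A Presburger function as a motivic function. -/
def PFun.toMotFun (e : Kind) {B : Set (Point.{u} C V)} (F : PFun B) : MotFun e B :=
  Ideal.Quotient.mk (amalgIdeal e B) (F ⊗ₜ[ℤ] 1)

end MotivicFunctions

/-! ### Pullback of motivic functions -/

section Pullback

variable {C : Sorts.{v}} {V V' : Sorts.{0}}

/-- A definable map from `B'` to `B`: preimages of definable families of sets are definable. -/
structure DefMap (B' : Set (Point.{u} C V')) (B : Set (Point.{u} C V)) where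
  toFun : ∀ K : DPModel.{u} C, Assign K.k V' → Assign K.k V
  maps : ∀ p ∈ B', (⟨p.K, toFun p.K p.x⟩ : Point.{u} C V) ∈ B
  definable : ∀ (W : Sorts.{0}) (φ : Formula C (V.prod W)), ∃ φ' : Formula C (V'.prod W),
    ∀ p ∈ B', ∀ y : Assign p.K.k W,
      φ'.Realize p.K (p.x.append y) ↔ φ.Realize p.K ((toFun p.K p.x).append y)

variable {B' : Set (Point.{u} C V')} {B : Set (Point.{u} C V)} (π : DefMap B' B) {e : Kind}

def DefMap.pt (p : B') : B := ⟨⟨p.1.K, π.toFun p.1.K p.1.x⟩, π.maps p.1 p.2⟩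

theorem DefMap.defSet {n : ℕ} {Z : ∀ p : B, Set (Fin n → p.1.K.k)} (hZ : DefSet B Z) :
    DefSet B' (fun p => Z (π.pt p)) := by
  obtain ⟨φ, hφ⟩ := hZ
  obtain ⟨ψ, hψ⟩ := π.definable _ φ
  exact ⟨ψ, fun p y => (hψ p.1 p.2 _).trans (hφ (π.pt p) y)⟩

theorem DefMap.defMapRF {n m : ℕ} {Y : ∀ p : B, Set (Fin n → p.1.K.k)}
    {h : ∀ p : B, (Fin n → p.1.K.k) → (Fin m → p.1.K.k)} (hh : DefMapRF B Y h) :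
    DefMapRF B' (fun p => Y (π.pt p)) (fun p => h (π.pt p)) := by
  obtain ⟨φ, hφ⟩ := hh
  obtain ⟨ψ, hψ⟩ := π.definable _ φ
  exact ⟨ψ, fun p y hy z => (hψ p.1 p.2 _).trans (hφ (π.pt p) y hy z)⟩

theorem DefMap.defMapVF {n : ℕ} {Y : ∀ p : B, Set (Fin n → p.1.K.k)}
    {g : ∀ p : B, (Fin n → p.1.K.k) → LaurentSeries p.1.K.k} (hg : DefMapVF B Y g) :
    DefMapVF B' (fun p => Y (π.pt p)) (fun p => g (π.pt p)) := by
  obtain ⟨φ, hφ⟩ := hg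
  obtain ⟨ψ, hψ⟩ := π.definable _ φ
  exact ⟨ψ, fun p y hy z => (hψ p.1 p.2 _).trans (hφ (π.pt p) y hy z)⟩

theorem DefMap.defFunVG {α : B → ℤ} (hα : DefFunVG B α) :
    DefFunVG B' (fun p => α (π.pt p)) := by
  obtain ⟨φ, hφ⟩ := hα
  obtain ⟨ψ, hψ⟩ := π.definable _ φ
  exact ⟨ψ, fun p z => (hψ p.1 p.2 _).trans (hφ (π.pt p) z)⟩

/-- Pullback (base change) of a triple `(Y, ξ, g)`. -/
def Obj.pull (a : Obj e B) : Obj e B' where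
  n := a.n
  Y := fun p => a.Y (π.pt p)
  ξ := fun p => a.ξ (π.pt p)
  g := fun p => a.g (π.pt p)
  defY := π.defSet a.defY
  defξ := π.defMapRF a.defξ
  defg := π.defMapVF a.defg
  plain := fun h p y hy => a.plain h (π.pt p) y hy

theorem relIdeal_le_comap :
    relIdeal e B ≤ (relIdeal e B').comap (FreeCommRing.map (Obj.pull (e := e) π)) := by
  refine Ideal.span_le.2 ?_
  rintro _ ⟨x, y, hxy, rfl⟩
  refine Ideal.subset_span ⟨_, _, ?_, map_sub _ x y⟩
  cases hxy with
  | iso a b h hh hc =>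
    simp only [FreeCommRing.map_of]
    exact .iso _ _ (fun p => h (π.pt p)) ⟨π.defMapRF hh.1, fun p => hh.2 (π.pt p)⟩
      (fun p => hc (π.pt p))
  | empty a ha =>
    simp only [FreeCommRing.map_of, map_zero]
    exact .empty _ (fun p => ha (π.pt p))
  | scissor a Z Z' hZ hZ' =>
    simp only [FreeCommRing.map_of, map_add]
    exact Rel.scissor (a.pull π) (fun p => Z (π.pt p)) (fun p => Z' (π.pt p)) (π.defSet hZ)
      (π.defSet hZ')
  | residue a b h hh hc =>
    simp only [FreeCommRing.map_of]
    exact .residue _ _ (fun p => h (π.pt p)) ⟨π.defMapRF hh.1, fun p => hh.2 (π.pt p)⟩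
      (fun p => hc (π.pt p))
  | line a b h q hh hq hb hc =>
    simp only [FreeCommRing.map_of, map_zero]
    exact .line (a.pull π) (b.pull π) (fun p => h (π.pt p)) (fun p => q (π.pt p))
      (π.defMapRF hh) (π.defMapRF hq) (fun p => hb (π.pt p)) (fun p => hc (π.pt p))
  | unit a hn hY ht =>
    simp only [FreeCommRing.map_of, map_one]
    exact .unit _ hn (fun p => hY (π.pt p)) (fun p => ht (π.pt p))
  | prod a b c h h' hh hh' hb hc =>
    simp only [FreeCommRing.map_of, map_mul]
    exact .prod (a.pull π) (b.pull π) (c.pull π) (fun p => h (π.pt p)) (fun p => h' (π.pt p))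
      (π.defMapRF hh) (π.defMapRF hh') (fun p => hb (π.pt p)) (fun p => hc (π.pt p))

/-- Pullback on Grothendieck rings. -/
def K0.pull (e : Kind) : K0 e B →+* K0 e B' :=
  Ideal.quotientMap (relIdeal e B') (FreeCommRing.map (Obj.pull (e := e) π)) (relIdeal_le_comap π)

/-- Composition with `π` on the rings of all functions. -/
def compRingHom : (B → RatFunc ℚ) →+* (B' → RatFunc ℚ) where
  toFun F := F ∘ π.pt
  map_one' := rfl
  map_mul' _ _ := rfl
  map_zero' := rfl
  map_add' _ _ := rfl

theorem compRingHom_mem (F : B → RatFunc ℚ) (hF : F ∈ PFun B) : compRingHom π F ∈ PFun B' := by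
  have h : PFun B ≤ (PFun B').comap (compRingHom π) := by
    refine Subring.closure_le.2 ?_
    rintro F ((⟨a, ha, rfl⟩ | ⟨α, hα, rfl⟩) | ⟨β, hβ, rfl⟩)
    · exact Subring.subset_closure (Or.inl (Or.inl ⟨a, ha, rfl⟩))
    · exact Subring.subset_closure (Or.inl (Or.inr ⟨_, π.defFunVG hα, rfl⟩))
    · exact Subring.subset_closure (Or.inr ⟨_, π.defFunVG hβ, rfl⟩)
  exact h hF

/-- Pullback of Presburger functions. -/
def PFun.pull : PFun B →+* PFun B' :=
  (compRingHom π).restrict (PFun B) (PFun B') (compRingHom_mem π)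

/-- Pullback on `𝒫 ⊗ K₀`. -/
def tensorPull (e : Kind) : PFun B ⊗[ℤ] K0 e B →+* PFun B' ⊗[ℤ] K0 e B' :=
  (Algebra.TensorProduct.map (PFun.pull π).toIntAlgHom (K0.pull π e).toIntAlgHom).toRingHom

theorem amalgIdeal_le_comap : amalgIdeal e B ≤ (amalgIdeal e B').comap (tensorPull π e) := by
  refine Ideal.span_le.2 ?_
  have key : ∀ (a : Obj e B) (F : PFun B),
      tensorPull π e (F ⊗ₜ[ℤ] 1 - 1 ⊗ₜ[ℤ] a.cls) =
        PFun.pull π F ⊗ₜ[ℤ] 1 - 1 ⊗ₜ[ℤ] (a.pull π).cls := by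
    intro a F
    have h : K0.pull π e a.cls = (a.pull π).cls := by
      change Ideal.quotientMap (relIdeal e B') _ _ (Ideal.Quotient.mk _ _) = _
      rw [Ideal.quotientMap_mk, FreeCommRing.map_of]
      rfl
    simp [tensorPull, h]
  rintro _ (⟨a, F, hn, ht, hF, rfl⟩ | ⟨a, F, hn, ht, hY, hF, rfl⟩)
  · refine Ideal.subset_span (Or.inl ⟨a.pull π, PFun.pull π F, hn, fun p => ht (π.pt p),
      fun p => hF (π.pt p), key a F⟩)
  · refine Ideal.subset_span (Or.inr ⟨a.pull π, PFun.pull π F, hn, fun p => ht (π.pt p),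
      fun p => hY (π.pt p), fun p => hF (π.pt p), key a F⟩)

/-- Pullback `π^*` of motivic functions along a definable map `π`. -/
def MotFun.pull (e : Kind) : MotFun e B →+* MotFun e B' :=
  Ideal.quotientMap (amalgIdeal e B') (tensorPull π e) (amalgIdeal_le_comap π)

end Pullback

section Restriction

variable {C : Sorts.{v}} {V : Sorts.{0}} {e : Kind}

/-- An inclusion of sets of points, with the same formulas defining subsets. -/
def DefMap.inclusion {B' B : Set (Point.{u} C V)} (h : B' ⊆ B) : DefMap B' B where
  toFun _ x := x
  maps _ hp := h hp
  definable _ φ := ⟨φ, fun _ _ _ => Iff.rfl⟩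

/-- Restriction of a motivic function to a set of points `B' ⊆ B`. -/
def MotFun.restrict {B' B : Set (Point.{u} C V)} (h : B' ⊆ B) (f : MotFun e B) : MotFun e B' :=
  MotFun.pull (.inclusion h) e f

end Restriction

/-! ### Motivic functions on `VG_{≥ 0}^r × A` -/

section Shape

variable {C : Sorts.{v}} {V : Sorts.{0}} {e : Kind}

/-- (The set of points of) `VG_{≥ 0}^r × A`. -/
def vgProd (r : ℕ) (A : Set (Point.{u} C V)) : Set (Point.{u} C ((ambient 0 0 r).prod V)) :=
  {p | (∀ i, 0 ≤ p.fst.x.vg i) ∧ p.snd ∈ A}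

variable {r : ℕ} {A : Set (Point.{u} C V)}

/-- The projection `VG_{≥ 0}^r × A → A`. -/
def projA (r : ℕ) (A : Set (Point.{u} C V)) : DefMap (vgProd r A) A where
  toFun _ x := x.snd
  maps _ hp := hp.2
  definable W φ := by
    refine ⟨φ.rename ⟨Sum.map Sum.inr id, Sum.map Sum.inr id, Sum.map Sum.inr id⟩,
      fun _ _ y => ?_⟩
    rw [Formula.realize_rename]
    refine iff_of_eq (congrArg _ ?_)
    ext i <;> rcases i with i | i <;> rfl

theorem exists_linear_term (b : Fin r → ℤ) :
    ∃ s : VGTerm C ((ambient 0 0 r).prod V), ∀ (K : DPModel.{u} C) (x : Assign K.k _),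
      s.eval K x = ∑ i, b i * x.fst.vg i := by
  have smul : ∀ (n : ℤ) (i : Fin r), ∃ s : VGTerm C ((ambient 0 0 r).prod V),
      ∀ (K : DPModel.{u} C) (x : Assign K.k _), s.eval K x = n * x.fst.vg i := by
    intro n i
    induction n with
    | zero => exact ⟨.zero, fun K x => by simp [VGTerm.eval]⟩
    | succ n ih =>
      obtain ⟨s, hs⟩ := ih
      exact ⟨.add s (.var (Sum.inl i)), fun K x => by
        simp only [VGTerm.eval, hs, Assign.fst]; ring⟩
    | pred n ih =>
      obtain ⟨s, hs⟩ := ih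
      exact ⟨.add s (.neg (.var (Sum.inl i))), fun K x => by
        simp only [VGTerm.eval, hs, Assign.fst]; ring⟩
  have sum : ∀ T : Finset (Fin r), ∃ s : VGTerm C ((ambient 0 0 r).prod V),
      ∀ (K : DPModel.{u} C) (x : Assign K.k _), s.eval K x = ∑ i ∈ T, b i * x.fst.vg i := by
    intro T
    induction T using Finset.induction_on with
    | empty => exact ⟨.zero, fun K x => by simp [VGTerm.eval]⟩
    | insert i T hi ih =>
      obtain ⟨s, hs⟩ := ih
      obtain ⟨t, ht⟩ := smul (b i) i
      exact ⟨.add t s, fun K x => by simp [VGTerm.eval, hs, ht, Finset.sum_insert hi]⟩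
  exact sum Finset.univ

/-- `b · g = b_1 g_1 + ⋯ + b_r g_r` is a definable function on `VG_{≥ 0}^r × A`. -/
theorem defFunVG_linear (b : Fin r → ℤ) :
    DefFunVG (vgProd r A) (fun p => ∑ i, b i * p.1.fst.x.vg i) := by
  obtain ⟨s, hs⟩ := exists_linear_term (C := C) (V := V) b
  refine ⟨.eqVG (s.rename ⟨Sum.inl, Sum.inl, Sum.inl⟩) (.var (Sum.inr 0)), fun p z => ?_⟩
  have h := (VGTerm.eval_rename ⟨Sum.inl, Sum.inl, Sum.inl⟩ p.1.K
    (p.1.x.append (vgPt (r := 1) fun _ => z)) s).trans (hs _ _)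
  exact iff_of_eq (congrArg (· = z) h)

theorem defFunVG_coord (i : Fin r) : DefFunVG (vgProd r A) (fun p => p.1.fst.x.vg i) :=
  ⟨.eqVG (.var (Sum.inl (Sum.inl i))) (.var (Sum.inr 0)), fun _ _ => Iff.rfl⟩

/-- The coordinate function `g_i` as a motivic function on `VG_{≥ 0}^r × A`. -/
def coordFun (e : Kind) (A : Set (Point.{u} C V)) (i : Fin r) : MotFun e (vgProd r A) :=
  PFun.toMotFun e ⟨fun p => ((p.1.fst.x.vg i : ℤ) : RatFunc ℚ),
    Subring.subset_closure (Or.inl (Or.inr ⟨_, defFunVG_coord i, rfl⟩))⟩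

/-- `𝕃^{b · g}` as a motivic function on `VG_{≥ 0}^r × A`. -/
def expFun (e : Kind) (A : Set (Point.{u} C V)) (b : Fin r → ℤ) : MotFun e (vgProd r A) :=
  PFun.toMotFun e ⟨fun p => LL ^ (∑ i, b i * p.1.fst.x.vg i),
    Subring.subset_closure (Or.inr ⟨_, defFunVG_linear b, rfl⟩)⟩

/-- The motivic function `∑_{(a,b) ∈ L} c_{a,b} g^a 𝕃^{b · g}` on `VG_{≥ 0}^r × A`. -/
def shapeSum (L : Finset ((Fin r → ℕ) × (Fin r → ℤ)))
    (c : (Fin r → ℕ) × (Fin r → ℤ) → MotFun e A) : MotFun e (vgProd r A) :=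
  ∑ ab ∈ L, MotFun.pull (projA r A) e (c ab) * (∏ i, coordFun e A i ^ ab.1 i) * expFun e A ab.2

/-- (The set of points of) `{x} × A`, for `x ∈ ℕ^r`. As every integer is named by a closed term,
this is an `S`-definable subset of `VG_{≥ 0}^r × A`. -/
def fiber (A : Set (Point.{u} C V)) (x : Fin r → ℕ) :
    Set (Point.{u} C ((ambient 0 0 r).prod V)) :=
  {p | p ∈ vgProd r A ∧ ∀ i, p.fst.x.vg i = x i}

theorem fiber_subset (A : Set (Point.{u} C V)) (x : Fin r → ℕ) : fiber A x ⊆ vgProd r A :=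
  fun _ hp => hp.1

/-- (The set of points of) `{x} × A`, for a point `x = (K, x)` on `VG_{≥ 0}^r`, considered as a set
definable over the class `S(x)` of all `(K', x')`, with `K'` in `S`, that are elementarily
equivalent to `(K, x)`. -/
def pointFiber (A : Set (Point.{u} C V)) (x : Point.{u} C (ambient 0 0 r)) :
    Set (Point.{u} C ((ambient 0 0 r).prod V)) :=
  {p | p ∈ vgProd r A ∧ SameType p.fst x}

theorem pointFiber_subset (A : Set (Point.{u} C V)) (x : Point.{u} C (ambient 0 0 r)) :
    pointFiber A x ⊆ vgProd r A :=
  fun _ hp => hp.1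

/-- (The set of points of) `VG_{≥ 0}^r × A` over the class of all structures in `S` that are
elementarily equivalent to `K`. -/
def overStructure (r : ℕ) (A : Set (Point.{u} C V)) (K : DPModel.{u} C) :
    Set (Point.{u} C ((ambient 0 0 r).prod V)) :=
  {p | p ∈ vgProd r A ∧ ElemEquiv p.K K}

theorem overStructure_subset (r : ℕ) (A : Set (Point.{u} C V)) (K : DPModel.{u} C) :
    overStructure r A K ⊆ vgProd r A :=
  fun _ hp => hp.1

end Shape

end Motivic

end

/-!
The functions `e_{a,b}(x) = x^a 𝕃^{b · x}` on `ℕ^r` with `(a, b) ∈ L` are determined by their values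
on a finite box `[0, N)^r`, through coefficients that do not depend on `(a, b)` and are themselves
Presburger functions: `e_{a,b}(x) = ∑ j, Φ_j(x) e_{a,b}(j)`
(`exists_monomialValue_interpolation`). Hence, as a motivic function on `VG_{≥ 0}^r × A`,
`f = ∑ j, Φ_j(g) · (∑ c_{a,b} e_{a,b}(j))`, and `f` vanishes as soon as its values
`∑ c_{a,b} e_{a,b}(j)` vanish in the ring of motivic functions on `A`
(`shapeSum_eq_zero_of_shapeValue`). These values are pullbacks of the restrictions of `f` to
`{j} × A` along `A → {j} × A` (`shapeValue_eq_zero_of_restrict`), and the integers `j` are named by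
closed terms, so that the type of a point `(K, j)` depends only on the theory of `K`.

The existence of the `Φ_j` with coefficients in `𝔸` is the point of the argument, since integers are
not invertible in `𝔸`. In one variable, `e_{a,b}` is annihilated by a product of operators
`E - 𝕃^b`, with `E` the shift, and solving one first order recurrence at a time stays within the
`𝔸`-span of the functions `binom(x, a) 𝕃^{b x}` (`exists_expPoly_recurrence`): different roots need
only the inverses of `𝕃^b - 𝕃^c`, which are in `𝔸`, and equal roots raise the lower index of
the binomial coefficient. Finally `binom(x, a)` is a Presburger function, because it is an integral
polynomial in `x` and `⌊x / a!⌋` on each residue class modulo `a!` (`choose_mem_PFun`).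
-/

noncomputable section

open scoped TensorProduct

namespace Motivic

/-! ### Exponential polynomials on `ℕ` -/

theorem LL_ne_zero : (LL : RatFunc ℚ) ≠ 0 := RatFunc.X_ne_zero

theorem LL_zpow_mem (b : ℤ) : LL ^ b ∈ coeffRing := by
  have h1 : LL ∈ coeffRing := Subring.subset_closure (by simp)
  have h2 : LL⁻¹ ∈ coeffRing := Subring.subset_closure (by simp)
  obtain ⟨n, rfl | rfl⟩ := b.eq_nat_or_neg
  · simpa using pow_mem h1 n
  · simpa using pow_mem h2 n

theorem LL_pow_ne_one {i : ℕ} (hi : 0 < i) : LL ^ i ≠ 1 := by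
  intro h
  have h1 : (algebraMap (Polynomial ℚ) (RatFunc ℚ)) (Polynomial.X ^ i) = algebraMap _ _ 1 := by
    simpa using h
  have h2 := congrArg (Polynomial.eval 0) (RatFunc.algebraMap_injective ℚ h1)
  simp [hi.ne'] at h2

/-- Differences of distinct powers of `𝕃` are units of `𝔸`. -/
theorem exists_inv_LL_zpow_sub {b c : ℤ} (h : b ≠ c) :
    ∃ γ ∈ coeffRing, γ * (LL ^ b - LL ^ c) = 1 := by
  wlog hlt : c < b generalizing b c
  · obtain ⟨γ, hγ, h1⟩ := this h.symm (lt_of_le_of_ne (not_lt.1 hlt) h)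
    exact ⟨-γ, neg_mem hγ, by rw [← h1]; ring⟩
  obtain ⟨i, hi⟩ := Int.eq_ofNat_of_zero_le (sub_pos.2 hlt).le
  have hpos : 0 < i := by omega
  obtain rfl : b = c + i := by omega
  have hne : (1 - LL⁻¹ ^ i : RatFunc ℚ) ≠ 0 := by
    intro h0
    apply LL_pow_ne_one hpos
    rw [inv_pow, sub_eq_zero, eq_comm, inv_eq_one] at h0
    exact h0
  refine ⟨LL ^ (-(c + i : ℤ)) * (1 - LL⁻¹ ^ i)⁻¹, mul_mem (LL_zpow_mem _)
    (Subring.subset_closure (Or.inr ⟨i, hpos, rfl⟩)), ?_⟩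
  have h1 : (LL ^ (c + i : ℤ) - LL ^ c : RatFunc ℚ) = LL ^ (c + i : ℤ) * (1 - LL⁻¹ ^ i) := by
    rw [mul_sub, mul_one, inv_pow, zpow_add₀ LL_ne_zero, zpow_natCast, mul_assoc,
      mul_inv_cancel₀ (pow_ne_zero _ LL_ne_zero), mul_one]
  have h2 : (LL ^ (c + i : ℤ) : RatFunc ℚ) ≠ 0 := zpow_ne_zero _ LL_ne_zero
  rw [h1, zpow_neg, mul_mul_mul_comm, inv_mul_cancel₀ h2, inv_mul_cancel₀ hne, one_mul]

/-- The `𝔸`-module of exponential polynomials on `ℕ` spanned by the functions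
`x ↦ binom(x, a) 𝕃^{b x}`. Binomial coefficients are used instead of powers of `x`, because only
the former are stable under summation without dividing by integers, which are not invertible
in `𝔸`. -/
def expPoly : Submodule coeffRing (ℕ → RatFunc ℚ) :=
  Submodule.span coeffRing
    (Set.range fun ab : ℕ × ℤ => fun x : ℕ => (x.choose ab.1 : RatFunc ℚ) * LL ^ (ab.2 * x))

theorem choose_mul_LL_mem (a : ℕ) (b : ℤ) :
    (fun x : ℕ => (x.choose a : RatFunc ℚ) * LL ^ (b * x)) ∈ expPoly :=
  Submodule.subset_span ⟨(a, b), rfl⟩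

theorem LL_pow_mem_expPoly (b : ℤ) : (fun x : ℕ => (LL ^ (b * x) : RatFunc ℚ)) ∈ expPoly := by
  simpa using choose_mul_LL_mem 0 b

theorem const_mul_mem_expPoly {γ : RatFunc ℚ} (hγ : γ ∈ coeffRing) {u : ℕ → RatFunc ℚ}
    (hu : u ∈ expPoly) : (fun x => γ * u x) ∈ expPoly :=
  expPoly.smul_mem (⟨γ, hγ⟩ : coeffRing) hu

theorem LL_zpow_mul_succ (b : ℤ) (x : ℕ) :
    (LL ^ (b * (x + 1 : ℕ)) : RatFunc ℚ) = LL ^ b * LL ^ (b * x) := by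
  rw [← zpow_add₀ LL_ne_zero]
  congr 1
  push_cast
  ring

/-- Exponential polynomials are closed under solving first order recurrences with characteristic
root a power of `𝕃`. -/
theorem exists_expPoly_recurrence (c : ℤ) {v : ℕ → RatFunc ℚ} (hv : v ∈ expPoly) :
    ∃ u ∈ expPoly, u 0 = 0 ∧ ∀ x, u (x + 1) = LL ^ c * u x + v x := by
  induction hv using Submodule.span_induction with
  | zero => exact ⟨0, zero_mem _, rfl, by simp⟩
  | add v w _ _ hv hw =>
    obtain ⟨u, hu, h0, h1⟩ := hv
    obtain ⟨u', hu', h0', h1'⟩ := hw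
    refine ⟨u + u', add_mem hu hu', by simp [h0, h0'], fun x => ?_⟩
    simp only [Pi.add_apply, h1, h1']
    ring
  | smul γ v _ hv =>
    obtain ⟨u, hu, h0, h1⟩ := hv
    refine ⟨γ • u, expPoly.smul_mem γ hu, by simp [h0], fun x => ?_⟩
    simp only [Pi.smul_apply, h1, smul_add, mul_smul_comm]
  | mem v hv =>
    obtain ⟨⟨a, b⟩, rfl⟩ := hv
    dsimp only
    rcases eq_or_ne b c with rfl | hbc
    · -- In the resonant case the sum of `binom(x, a)` is `binom(x, a + 1)`.
      refine ⟨_, const_mul_mem_expPoly (LL_zpow_mem (-b)) (choose_mul_LL_mem (a + 1) b),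
        by simp, fun x => ?_⟩
      simp only [LL_zpow_mul_succ, Nat.choose_succ_succ, zpow_neg,
        Nat.cast_add (R := RatFunc ℚ)]
      have := zpow_ne_zero b LL_ne_zero
      field_simp
      ring
    · obtain ⟨γ, hγ, h1⟩ := exists_inv_LL_zpow_sub hbc
      induction a with
      | zero =>
        refine ⟨_, const_mul_mem_expPoly hγ
          (sub_mem (LL_pow_mem_expPoly b) (LL_pow_mem_expPoly c)), by simp, fun x => ?_⟩
        simp only [Pi.sub_apply, LL_zpow_mul_succ, Nat.choose_zero_right, Nat.cast_one]
        linear_combination (LL ^ (b * x)) * h1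
      | succ a ih =>
        obtain ⟨w, hw, hw0, hw1⟩ := ih
        refine ⟨_, const_mul_mem_expPoly hγ (sub_mem (choose_mul_LL_mem (a + 1) b)
          (const_mul_mem_expPoly (LL_zpow_mem b) hw)), by simp [hw0], fun x => ?_⟩
        simp only [Pi.sub_apply, LL_zpow_mul_succ, Nat.choose_succ_succ, hw1,
          Nat.cast_add (R := RatFunc ℚ)]
        linear_combination (((x.choose a + x.choose (a + 1)) : RatFunc ℚ) * LL ^ (b * x)) * h1 -
          ((x.choose a : RatFunc ℚ) * LL ^ (b * x)) * h1

/-! ### Interpolation -/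

/-- `e` is annihilated by the product over `b ∈ Λ` of the difference operators `E - 𝕃^b`, where `E`
is the shift. -/
def Annihilated : List ℤ → (ℕ → RatFunc ℚ) → Prop
  | [], e => ∀ x, e x = 0
  | b :: Λ, e => Annihilated Λ fun x => e (x + 1) - LL ^ b * e x

/-- The solutions of a linear recurrence with characteristic roots powers of `𝕃` are determined by
finitely many of their values, through coefficients that are exponential polynomials. -/
theorem exists_interpolation (Λ : List ℤ) :
    ∃ (N : ℕ) (φ : ℕ → ℕ → RatFunc ℚ), (∀ j, φ j ∈ expPoly) ∧
      ∀ e, Annihilated Λ e → ∀ x, e x = ∑ j ∈ Finset.range N, φ j x * e j := by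
  induction Λ with
  | nil => exact ⟨0, fun _ => 0, fun _ => zero_mem _, fun e he x => by simpa using he x⟩
  | cons b Λ ih =>
    obtain ⟨N, φ, hφ, h⟩ := ih
    choose u hu hu0 hu1 using fun j => exists_expPoly_recurrence b (hφ j)
    -- Solving `e(x + 1) - 𝕃^b e(x) = ∑ j, φ j x * (e(j + 1) - 𝕃^b e(j))` gives
    -- `e(x) = 𝕃^{b x} e(0) + ∑ j, u j x * (e(j + 1) - 𝕃^b e(j))`.
    let ψ : ℕ → ℕ → RatFunc ℚ := fun j =>
      (if j = 0 then fun x : ℕ => LL ^ (b * x) else 0) +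
        ((if j = 0 then 0 else u (j - 1)) - if j < N then (fun x => LL ^ b * u j x) else 0)
    refine ⟨N + 1, ψ, fun j => ?_, fun e he x => ?_⟩
    · refine add_mem ?_ (sub_mem ?_ ?_)
      · split_ifs
        exacts [LL_pow_mem_expPoly b, zero_mem _]
      · split_ifs
        exacts [zero_mem _, hu _]
      · split_ifs
        exacts [const_mul_mem_expPoly (LL_zpow_mem b) (hu j), zero_mem _]
    · have key : e x = LL ^ (b * x) * e 0 +
          ∑ j ∈ Finset.range N, u j x * (e (j + 1) - LL ^ b * e j) := by
        induction x with
        | zero => simp [hu0]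
        | succ x ihx =>
          have hx := h _ he x
          have : e (x + 1) = LL ^ b * e x +
              ∑ j ∈ Finset.range N, φ j x * (e (j + 1) - LL ^ b * e j) := by
            rw [← hx]; ring
          rw [this, ihx, LL_zpow_mul_succ, mul_add, add_assoc, Finset.mul_sum,
            ← Finset.sum_add_distrib, mul_assoc]
          congr 1
          refine Finset.sum_congr rfl fun j _ => ?_
          rw [hu1]
          ring
      have h1 : ∀ j, ψ j x * e j = (if j = 0 then LL ^ (b * x) * e 0 else 0) +
          ((if j = 0 then 0 else u (j - 1) x * e j) -
            if j < N then LL ^ b * u j x * e j else 0) := by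
        intro j
        simp only [ψ]
        split_ifs <;> simp_all [add_mul, sub_mul]
      rw [key, Finset.sum_congr rfl fun j _ => h1 j, Finset.sum_add_distrib,
        Finset.sum_sub_distrib]
      congr 1
      · simp
      · rw [Finset.sum_range_succ', Finset.sum_range_succ]
        simp only [Nat.add_eq_zero_iff, one_ne_zero, and_false, if_false, if_true,
          Nat.add_sub_cancel, add_zero, lt_irrefl]
        rw [Finset.sum_congr rfl fun j hj => if_pos (Finset.mem_range.1 hj),
          ← Finset.sum_sub_distrib]
        refine Finset.sum_congr rfl fun j _ => ?_
        ring

open Polynomial in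
theorem annihilated_polynomial_mul_LL (Λ : List ℤ) (b : ℤ) (p : (RatFunc ℚ)[X])
    (hp : p.degree < Λ.count b) : Annihilated Λ fun x => p.eval (x : RatFunc ℚ) * LL ^ (b * x) := by
  induction Λ generalizing p with
  | nil =>
    intro x
    have : p = 0 := by simpa [Nat.WithBot.lt_zero_iff] using hp
    simp [this]
  | cons c Λ ih =>
    have h : (fun x : ℕ => p.eval ((x + 1 : ℕ) : RatFunc ℚ) * LL ^ (b * (x + 1 : ℕ)) -
        LL ^ c * (p.eval (x : RatFunc ℚ) * LL ^ (b * x))) =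
        fun x : ℕ => (C (LL ^ b) * p.comp (X + 1) - C (LL ^ c) * p).eval (x : RatFunc ℚ) *
          LL ^ (b * x) := by
      funext x
      rw [LL_zpow_mul_succ]
      simp only [eval_sub, eval_mul, eval_C, eval_comp, eval_add, eval_X, eval_one]
      push_cast
      ring
    change Annihilated Λ _
    rw [h]
    apply ih
    have hdeg : (p.comp (X + 1)).degree = p.degree := by
      rw [← map_one C, ← taylor_apply, degree_taylor]
    rcases eq_or_ne c b with rfl | hcb
    · rcases eq_or_ne p 0 with rfl | hp0
      · simp [bot_lt_iff_ne_bot]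
      · have h1 : (p.comp (X + 1) - p).degree < p.degree := by
          rw [← hdeg]
          refine degree_sub_lt_left hdeg ?_ ?_
          · intro h0
            rw [h0, degree_zero] at hdeg
            exact hp0 (degree_eq_bot.1 hdeg.symm)
          · rw [← map_one C, ← taylor_apply, leadingCoeff_taylor]
        rw [← mul_sub, degree_C_mul (zpow_ne_zero _ LL_ne_zero)]
        rw [List.count_cons_self, degree_eq_natDegree hp0] at hp
        rw [degree_eq_natDegree hp0] at h1
        refine h1.trans_le ?_
        have : p.natDegree < List.count c Λ + 1 := by exact_mod_cast hp
        exact_mod_cast Nat.lt_succ_iff.1 this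
    · rw [List.count_cons_of_ne hcb] at hp
      refine (degree_sub_le _ _).trans_lt (max_lt ?_ ?_)
      · rwa [degree_C_mul (zpow_ne_zero _ LL_ne_zero), hdeg]
      · rwa [degree_C_mul (zpow_ne_zero _ LL_ne_zero)]

theorem exists_list_count {ι : Type*} (s : Finset ι) (a : ι → ℕ) (b : ι → ℤ) :
    ∃ Λ : List ℤ, ∀ i ∈ s, a i < Λ.count (b i) := by
  classical
  refine ⟨(∑ i ∈ s, Multiset.replicate (a i + 1) (b i)).toList, fun i hi => ?_⟩
  rw [← Multiset.coe_count, Multiset.coe_toList, Multiset.count_sum']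
  refine lt_of_lt_of_le ?_
    (Finset.single_le_sum (f := fun j => Multiset.count (b i) (Multiset.replicate (a j + 1) (b j)))
      (fun _ _ => Nat.zero_le _) hi)
  simp

variable {r : ℕ}

/-- The value of `g^a 𝕃^{b · g}` at `x ∈ ℕ^r`. -/
def monomialValue (ab : (Fin r → ℕ) × (Fin r → ℤ)) (x : Fin r → ℕ) : RatFunc ℚ :=
  ∏ i, ((x i : RatFunc ℚ) ^ ab.1 i * LL ^ (ab.2 i * x i))

/-- The finitely many functions `g^a 𝕃^{b · g}` on `ℕ^r` are recovered from their values on a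
finite box through common coefficients, which are products of exponential polynomials. -/
theorem exists_monomialValue_interpolation (L : Finset ((Fin r → ℕ) × (Fin r → ℤ))) :
    ∃ (N : ℕ) (φ : ℕ → ℕ → RatFunc ℚ), (∀ j, φ j ∈ expPoly) ∧
      ∀ ab ∈ L, ∀ x, monomialValue ab x =
        ∑ j ∈ Fintype.piFinset fun _ : Fin r => Finset.range N,
          (∏ i, φ (j i) (x i)) * monomialValue ab j := by
  obtain ⟨Λ, hΛ⟩ := exists_list_count (L ×ˢ (Finset.univ : Finset (Fin r)))
    (fun q => q.1.1 q.2) (fun q => q.1.2 q.2)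
  obtain ⟨N, φ, hφ, h⟩ := exists_interpolation Λ
  refine ⟨N, φ, hφ, fun ab hab x => ?_⟩
  simp only [monomialValue]
  simp_rw [← Finset.prod_mul_distrib]
  rw [Finset.sum_prod_piFinset (Finset.range N) fun i j => φ j (x i) *
      ((j : RatFunc ℚ) ^ ab.1 i * LL ^ (ab.2 i * j))]
  refine Finset.prod_congr rfl fun i _ => ?_
  have := annihilated_polynomial_mul_LL Λ (ab.2 i) (Polynomial.X ^ ab.1 i) (by
    rw [Polynomial.degree_X_pow]
    exact_mod_cast hΛ (ab, i) (by simp [hab]))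
  simpa using h _ this (x i)

theorem monomialValue_mem (ab : (Fin r → ℕ) × (Fin r → ℤ)) (x : Fin r → ℕ) :
    monomialValue ab x ∈ coeffRing :=
  prod_mem fun _ _ => mul_mem (pow_mem (natCast_mem _ _) _) (LL_zpow_mem _)

variable {C : Sorts.{v}}

/-! ### Closed terms and substitution -/

theorem exists_numeral {V : Sorts.{0}} (n : ℤ) :
    ∃ t : VGTerm C V, ∀ (K : DPModel.{u} C) (x : Assign K.k V), t.eval K x = n := by
  induction n with
  | zero => exact ⟨.zero, fun K x => by simp [VGTerm.eval]⟩
  | succ n ih =>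
    obtain ⟨t, ht⟩ := ih
    exact ⟨.add t .one, fun K x => by simp [VGTerm.eval, ht]⟩
  | pred n ih =>
    obtain ⟨t, ht⟩ := ih
    exact ⟨.add t (.neg .one), fun K x => by simp [VGTerm.eval, ht, sub_eq_add_neg]⟩

theorem exists_nsmul_term {V : Sorts.{0}} (d : ℕ) (s : VGTerm C V) :
    ∃ t : VGTerm C V, ∀ (K : DPModel.{u} C) (x : Assign K.k V), t.eval K x = d * s.eval K x := by
  induction d with
  | zero => exact ⟨.zero, fun K x => by simp [VGTerm.eval]⟩
  | succ n ih =>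
    obtain ⟨t, ht⟩ := ih
    exact ⟨.add t s, fun K x => by simp only [VGTerm.eval, ht]; push_cast; ring⟩

/-- Integers are named by closed terms, so that they may be substituted for variables of
sort `VG`. -/
theorem exists_subst_vg {U : Sorts.{0}} {r : ℕ} (j : Fin r → ℤ)
    (φ : Formula C (U.prod (ambient 0 0 r))) :
    ∃ φ' : Formula C U, ∀ (K : DPModel.{u} C) (x : Assign K.k U),
      φ'.Realize K x ↔ φ.Realize K (x.append (vgPt j)) := by
  induction r with
  | zero =>
    refine ⟨φ.rename ⟨Sum.elim id Fin.elim0, Sum.elim id Fin.elim0, Sum.elim id Fin.elim0⟩,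
      fun K x => ?_⟩
    rw [Formula.realize_rename]
    refine iff_of_eq (congrArg _ ?_)
    ext i <;> rcases i with i | i
    all_goals first | rfl | exact i.elim0
  | succ r ih =>
    let ρ : Ren (U.prod (ambient 0 0 (r + 1))) ((U.prod (ambient 0 0 r)).prod (ambient 0 0 1)) :=
      ⟨Sum.elim (Sum.inl ∘ Sum.inl) Fin.elim0, Sum.elim (Sum.inl ∘ Sum.inl) Fin.elim0,
        Sum.elim (Sum.inl ∘ Sum.inl)
          (Fin.cases (Sum.inr 0) fun k => Sum.inl (Sum.inr k))⟩
    obtain ⟨t, ht⟩ := exists_numeral.{u} (C := C)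
      (V := (U.prod (ambient 0 0 r)).prod (ambient 0 0 1)) (j 0)
    obtain ⟨φ', hφ'⟩ := ih (fun k => j k.succ)
      (.exVG ((Formula.eqVG (.var (Sum.inr 0)) t).and (φ.rename ρ)))
    refine ⟨φ', fun K x => ?_⟩
    have h : ((x.append (vgPt fun k : Fin r => j k.succ)).append
        (vgPt (r := 1) fun _ => j 0)).comp ρ = x.append (vgPt j) := by
      ext i <;> rcases i with i | i
      all_goals first | rfl | (refine Fin.cases ?_ (fun k => ?_) i <;> rfl) | exact i.elim0
    rw [hφ']
    simp only [Formula.Realize, Formula.realize_rename, ht]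
    constructor
    · rintro ⟨z, hz, h1⟩
      obtain rfl : z = j 0 := hz
      rwa [h] at h1
    · exact fun h1 => ⟨j 0, rfl, by rwa [h]⟩

/-- A tuple of integers has the same type in elementarily equivalent structures. -/
theorem ElemEquiv.sameType_vgPt {K K' : DPModel.{u} C} (h : ElemEquiv K' K) {r : ℕ}
    (j : Fin r → ℤ) :
    SameType (⟨K', vgPt j⟩ : Point.{u} C (ambient 0 0 r)) ⟨K, vgPt j⟩ := by
  intro φ
  obtain ⟨φ', hφ'⟩ := exists_subst_vg.{u} (U := ambient 0 0 0) j
    (φ.rename ⟨Sum.inr, Sum.inr, Sum.inr⟩)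
  have key : ∀ K : DPModel.{u} C,
      φ'.Realize K (Assign.empty K.k) ↔ φ.Realize K (vgPt j) := fun K => by
    rw [hφ', Formula.realize_rename]
    rfl
  exact (key K').symm.trans ((h φ').trans (key K))

/-! ### Functoriality of pullback -/

section Functoriality

variable {V V' V'' : Sorts.{0}} {B : Set (Point.{u} C V)} {B' : Set (Point.{u} C V')}
  {B'' : Set (Point.{u} C V'')} {e : Kind}

/-- Composition of definable maps. -/
def DefMap.comp (π : DefMap B' B) (σ : DefMap B'' B') : DefMap B'' B where
  toFun K x := π.toFun K (σ.toFun K x)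
  maps p hp := π.maps _ (σ.maps p hp)
  definable W φ := by
    obtain ⟨φ', h'⟩ := π.definable W φ
    obtain ⟨φ'', h''⟩ := σ.definable W φ'
    exact ⟨φ'', fun p hp y => (h'' p hp y).trans (h' _ (σ.maps p hp) y)⟩

theorem K0.pull_pull (π : DefMap B' B) (σ : DefMap B'' B') (a : K0 e B) :
    K0.pull σ e (K0.pull π e a) = K0.pull (π.comp σ) e a := by
  obtain ⟨a, rfl⟩ := Ideal.Quotient.mk_surjective a
  have h : (FreeCommRing.map (Obj.pull (e := e) σ)).comp (FreeCommRing.map (Obj.pull π)) =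
      FreeCommRing.map (Obj.pull (π.comp σ)) := by
    refine FreeCommRing.hom_ext fun a => ?_
    simp only [RingHom.comp_apply, FreeCommRing.map_of]
    rfl
  exact congrArg (Ideal.Quotient.mk (relIdeal e B'')) (RingHom.congr_fun h a)

theorem MotFun.pull_pull (π : DefMap B' B) (σ : DefMap B'' B') (f : MotFun e B) :
    MotFun.pull σ e (MotFun.pull π e f) = MotFun.pull (π.comp σ) e f := by
  obtain ⟨f, rfl⟩ := Ideal.Quotient.mk_surjective f
  refine congrArg (Ideal.Quotient.mk (amalgIdeal e B''))
    (a₁ := tensorPull σ e (tensorPull π e f)) (a₂ := tensorPull (π.comp σ) e f) ?_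
  induction f using TensorProduct.induction_on with
  | zero => simp
  | add f g hf hg => simp only [map_add, hf, hg]
  | tmul F a =>
    change (PFun.pull σ (PFun.pull π F)) ⊗ₜ[ℤ] (K0.pull σ e (K0.pull π e a)) =
      PFun.pull (π.comp σ) F ⊗ₜ[ℤ] K0.pull (π.comp σ) e a
    rw [K0.pull_pull]
    rfl

theorem MotFun.restrict_self (f : MotFun e B) : MotFun.restrict (subset_refl B) f = f := by
  have hK : ∀ a : K0 e B, K0.pull (.inclusion (subset_refl B)) e a = a := by
    intro a
    obtain ⟨a, rfl⟩ := Ideal.Quotient.mk_surjective a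
    have h : FreeCommRing.map (Obj.pull (e := e) (.inclusion (subset_refl B))) =
        RingHom.id (FreeCommRing (Obj e B)) := by
      refine FreeCommRing.hom_ext fun a => ?_
      rw [FreeCommRing.map_of]
      rfl
    exact congrArg (Ideal.Quotient.mk (relIdeal e B)) (RingHom.congr_fun h a)
  obtain ⟨f, rfl⟩ := Ideal.Quotient.mk_surjective f
  refine congrArg (Ideal.Quotient.mk (amalgIdeal e B))
    (a₁ := tensorPull (.inclusion (subset_refl B)) e f) (a₂ := f) ?_
  induction f using TensorProduct.induction_on with
  | zero => simp
  | add f g hf hg => simp only [map_add, hf, hg]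
  | tmul F a =>
    change PFun.pull (.inclusion (subset_refl B)) F ⊗ₜ[ℤ] K0.pull (.inclusion (subset_refl B)) e a =
      F ⊗ₜ[ℤ] a
    rw [hK]
    rfl

/-- `PFun.toMotFun` as a ring homomorphism. -/
def PFun.toMotFunHom (e : Kind) (B : Set (Point.{u} C V)) : PFun B →+* MotFun e B :=
  (Ideal.Quotient.mk (amalgIdeal e B)).comp
    (Algebra.TensorProduct.includeLeftRingHom (R := ℤ) (A := PFun B) (B := K0 e B))

theorem MotFun.pull_toMotFunHom (π : DefMap B' B) (F : PFun B) :
    MotFun.pull π e (PFun.toMotFunHom e B F) = PFun.toMotFunHom e B' (PFun.pull π F) := by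
  refine congrArg (Ideal.Quotient.mk (amalgIdeal e B'))
    (a₁ := PFun.pull π F ⊗ₜ[ℤ] K0.pull π e 1) (a₂ := PFun.pull π F ⊗ₜ[ℤ] 1) ?_
  rw [map_one]

/-- A constant as a Presburger function. -/
def PFun.const (B : Set (Point.{u} C V)) (a : coeffRing) : PFun B :=
  ⟨fun _ => a, Subring.subset_closure (Or.inl (Or.inl ⟨a, a.2, rfl⟩))⟩

theorem MotFun.subsingleton_of_isEmpty [IsEmpty B] : Subsingleton (MotFun e B) := by
  refine subsingleton_of_zero_eq_one ?_
  rw [← map_one (PFun.toMotFunHom e B), ← map_zero (PFun.toMotFunHom e B)]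
  congr 1
  exact Subtype.ext (funext fun p => isEmptyElim p)

end Functoriality

/-! ### Exponential polynomials in the coordinates are Presburger functions -/

section Presburger

variable {V : Sorts.{0}} {r : ℕ} {A : Set (Point.{u} C V)}

/-- Presburger arithmetic defines division with remainder by a fixed positive integer. -/
theorem defFunVG_floor (i : Fin r) {d : ℕ} (hd : 0 < d) (s : ℤ) :
    DefFunVG (vgProd r A) (fun p => (p.1.fst.x.vg i - s) / d) := by
  let W : Sorts.{0} := ((ambient 0 0 r).prod V).prod (ambient 0 0 1)
  obtain ⟨t₁, h₁⟩ := exists_nsmul_term.{u} (C := C) (V := W) d (.var (Sum.inr 0))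
  obtain ⟨t₂, h₂⟩ := exists_numeral.{u} (C := C) (V := W) s
  obtain ⟨t₃, h₃⟩ := exists_numeral.{u} (C := C) (V := W) (d + s)
  refine ⟨(Formula.leVG (.add t₁ t₂) (.var (Sum.inl (Sum.inl i)))).and
    (Formula.leVG (.add t₁ t₃) (.var (Sum.inl (Sum.inl i)))).not, fun p z => ?_⟩
  simp only [Formula.Realize, VGTerm.eval, h₁, h₂, h₃]
  change ((d : ℤ) * z + s ≤ p.1.fst.x.vg i ∧ ¬ (d : ℤ) * z + (d + s) ≤ p.1.fst.x.vg i) ↔ _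
  have hd' : (0 : ℤ) < d := by exact_mod_cast hd
  rw [Int.ediv_eq_iff_of_pos hd']
  constructor
  · rintro ⟨h, h'⟩
    constructor <;> nlinarith
  · rintro ⟨h, h'⟩
    constructor <;> nlinarith

theorem intCast_mem_PFun {B : Set (Point.{u} C V)} {α : B → ℤ} (hα : DefFunVG B α) :
    (fun p => (α p : RatFunc ℚ)) ∈ PFun B :=
  Subring.subset_closure (Or.inl (Or.inr ⟨α, hα, rfl⟩))

theorem polynomial_eval_mem_PFun {B : Set (Point.{u} C V)} {α : B → ℤ}
    (hα : (fun p => (α p : RatFunc ℚ)) ∈ PFun B) (P : Polynomial ℤ) :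
    (fun p => ((P.eval (α p) : ℤ) : RatFunc ℚ)) ∈ PFun B := by
  induction P using Polynomial.induction_on' with
  | add P Q hP hQ =>
    simp only [Polynomial.eval_add, Int.cast_add]
    exact add_mem hP hQ
  | monomial n a =>
    simp only [Polynomial.eval_monomial, Int.cast_mul, Int.cast_pow]
    exact mul_mem (intCast_mem (PFun B) a) (pow_mem hα n)

/-- Binomial coefficients in the coordinates are Presburger functions, although `𝒫` does not
contain `1 / a!`: on a residue class of `x` modulo `a!` the function `binom(x, a)` is an integral
polynomial in `x` and `⌊x / a!⌋`. -/
theorem choose_mem_PFun (i : Fin r) (a : ℕ) :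
    (fun p : vgProd r A => (((p.1.fst.x.vg i).toNat.choose a : ℕ) : RatFunc ℚ)) ∈
      PFun (vgProd r A) := by
  set d := a.factorial with hd
  have hd0 : 0 < d := a.factorial_pos
  let P : Polynomial ℤ := descPochhammer ℤ a
  have hP : ∀ x : ℕ, P.eval (x : ℤ) = d * x.choose a := fun x => by
    rw [descPochhammer_eval_eq_descFactorial, Nat.descFactorial_eq_factorial_mul_choose]
    push_cast
    rfl
  choose G hG using fun s : ℤ => Polynomial.X_sub_C_dvd_sub_C_eval (p := P) (a := s)
  have hG' : ∀ s x : ℤ, P.eval x = P.eval s + (x - s) * (G s).eval x := fun s x => by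
    have := congrArg (Polynomial.eval x) (hG s)
    simp only [Polynomial.eval_sub, Polynomial.eval_mul, Polynomial.eval_X,
      Polynomial.eval_C] at this
    linarith
  -- The difference of the two quotients is the characteristic function of `x ≡ s` modulo `d`.
  have key : ∀ x : ℕ, (x.choose a : ℤ) = ∑ s ∈ Finset.range d,
      (((x : ℤ) - s) / d - ((x : ℤ) - (s + 1)) / d) *
        (s.choose a + ((x : ℤ) - s) / d * (G s).eval (x : ℤ)) := by
    intro x
    have hd' : (d : ℤ) ≠ 0 := by exact_mod_cast hd0.ne'
    rw [Finset.sum_eq_single (x % d)]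
    · have h1 : (x : ℤ) - (x % d : ℕ) = d * (x / d : ℕ) := by
        have := Nat.mod_add_div x d
        rw [sub_eq_iff_eq_add']
        exact_mod_cast this.symm
      have h2 : ((x : ℤ) - ((x % d : ℕ) + 1)) / d = (x / d : ℕ) - 1 := by
        rw [Int.ediv_eq_iff_of_pos (by exact_mod_cast hd0), ← sub_sub, h1]
        have : (1 : ℤ) ≤ d := by exact_mod_cast hd0
        constructor <;> nlinarith
      rw [h2, h1, Int.mul_ediv_cancel_left _ hd', sub_sub_cancel, one_mul]
      have h3 := hG' (x % d : ℕ) x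
      rw [hP, hP, h1, mul_assoc, ← mul_add] at h3
      exact mul_left_cancel₀ hd' h3
    · intro s hs hsx
      have hs' := Finset.mem_range.1 hs
      have : ((x : ℤ) - (s + 1)) / d = ((x : ℤ) - s) / d := by
        have hdp : (0 : ℤ) < d := by exact_mod_cast hd0
        have h4 := Int.emod_add_mul_ediv ((x : ℤ) - s) d
        have h5 := Int.emod_nonneg ((x : ℤ) - s) hd'
        have h6 := Int.emod_lt_of_pos ((x : ℤ) - s) hdp
        have h7 : ((x : ℤ) - s) % d ≠ 0 := fun h0 => by
          refine hsx ?_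
          have h8 : (x : ℤ) % d = s % d :=
            ((Int.modEq_iff_dvd (n := d)).2 (Int.dvd_of_emod_eq_zero h0)).symm
          have h9 : x % d = s % d := by exact_mod_cast h8
          rw [h9, Nat.mod_eq_of_lt hs']
        rw [Int.ediv_eq_iff_of_pos hdp]
        have h10 : 1 ≤ ((x : ℤ) - s) % d := by omega
        constructor <;> nlinarith
      rw [this, sub_self, zero_mul]
    · intro h
      exact absurd (Finset.mem_range.2 (Nat.mod_lt _ hd0)) h
  have h0 : (fun p : vgProd r A => (((p.1.fst.x.vg i).toNat.choose a : ℕ) : RatFunc ℚ)) =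
      ∑ s ∈ Finset.range d,
        ((fun p : vgProd r A => (((p.1.fst.x.vg i - (s : ℤ)) / d : ℤ) : RatFunc ℚ)) -
          fun p => (((p.1.fst.x.vg i - (s + 1 : ℤ)) / d : ℤ) : RatFunc ℚ)) *
        (((s.choose a : ℕ) : vgProd r A → RatFunc ℚ) +
          (fun p => (((p.1.fst.x.vg i - (s : ℤ)) / d : ℤ) : RatFunc ℚ)) *
            fun p => (((G s).eval (p.1.fst.x.vg i) : ℤ) : RatFunc ℚ)) := by
    funext p
    have h := congrArg (Int.cast : ℤ → RatFunc ℚ) (key (p.1.fst.x.vg i).toNat)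
    rw [Int.toNat_of_nonneg (p.2.1 i)] at h
    simp only [Finset.sum_apply, Pi.mul_apply, Pi.sub_apply, Pi.add_apply, Pi.natCast_apply]
    push_cast at h
    exact h
  rw [h0]
  exact sum_mem fun s _ => mul_mem
    (sub_mem (intCast_mem_PFun (defFunVG_floor i hd0 _)) (intCast_mem_PFun (defFunVG_floor i hd0 _)))
    (add_mem (natCast_mem _ _) (mul_mem (intCast_mem_PFun (defFunVG_floor i hd0 _))
      (polynomial_eval_mem_PFun (intCast_mem_PFun (defFunVG_coord i)) (G s))))

theorem expPoly_comp_coord_mem_PFun (i : Fin r) {φ : ℕ → RatFunc ℚ} (hφ : φ ∈ expPoly) :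
    (fun p : vgProd r A => φ (p.1.fst.x.vg i).toNat) ∈ PFun (vgProd r A) := by
  induction hφ using Submodule.span_induction with
  | zero => exact zero_mem (PFun (vgProd r A))
  | add φ ψ _ _ hφ hψ => exact add_mem hφ hψ
  | smul γ φ _ hφ => exact mul_mem (PFun.const (vgProd r A) γ).2 hφ
  | mem φ hφ =>
    obtain ⟨⟨a, b⟩, rfl⟩ := hφ
    refine mul_mem (choose_mem_PFun i a) ?_
    refine Subring.subset_closure (Or.inr ⟨_, defFunVG_linear (Pi.single i b), ?_⟩)
    funext p
    simp [Pi.single_apply, Int.toNat_of_nonneg (p.2.1 i)]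

end Presburger

/-! ### Vanishing of a motivic function from finitely many of its restrictions -/

section Vanishing

variable {V : Sorts.{0}} {r : ℕ} {A : Set (Point.{u} C V)} {e : Kind}

/-- The motivic function on `A` given by the values of `∑ c_{a,b} g^a 𝕃^{b · g}` at
`j ∈ ℕ^r`. -/
def shapeValue (L : Finset ((Fin r → ℕ) × (Fin r → ℤ)))
    (c : (Fin r → ℕ) × (Fin r → ℤ) → MotFun e A) (j : Fin r → ℕ) : MotFun e A :=
  ∑ ab ∈ L, c ab * PFun.toMotFunHom e A (PFun.const A ⟨_, monomialValue_mem ab j⟩)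

/-- `g^a 𝕃^{b · g}` as a Presburger function. -/
def monomialPFun (A : Set (Point.{u} C V)) (ab : (Fin r → ℕ) × (Fin r → ℤ)) :
    PFun (vgProd r A) :=
  (∏ i, ⟨fun p => ((p.1.fst.x.vg i : ℤ) : RatFunc ℚ), intCast_mem_PFun (defFunVG_coord i)⟩ ^ ab.1 i)
    * ⟨fun p => LL ^ (∑ i, ab.2 i * p.1.fst.x.vg i),
        Subring.subset_closure (Or.inr ⟨_, defFunVG_linear ab.2, rfl⟩)⟩

theorem LL_zpow_sum {ι : Type*} (s : Finset ι) (b : ι → ℤ) :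
    (LL ^ (∑ i ∈ s, b i) : RatFunc ℚ) = ∏ i ∈ s, LL ^ b i := by
  classical
  induction s using Finset.induction_on with
  | empty => simp
  | insert i s hi ih => rw [Finset.sum_insert hi, Finset.prod_insert hi, zpow_add₀ LL_ne_zero, ih]

theorem monomialPFun_apply (ab : (Fin r → ℕ) × (Fin r → ℤ)) (p : vgProd r A) :
    (monomialPFun A ab).1 p = monomialValue ab fun i => (p.1.fst.x.vg i).toNat := by
  have h : ∀ i, (((p.1.fst.x.vg i).toNat : ℕ) : ℤ) = p.1.fst.x.vg i := fun i =>
    Int.toNat_of_nonneg (p.2.1 i)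
  have h' : ∀ i, (((p.1.fst.x.vg i).toNat : ℕ) : RatFunc ℚ) = (p.1.fst.x.vg i : ℤ) := fun i => by
    rw [← Int.cast_natCast, h i]
  simp only [monomialPFun, monomialValue, h', h, Finset.prod_mul_distrib, ← LL_zpow_sum]
  simp [Finset.prod_apply]

theorem shapeSum_eq (L : Finset ((Fin r → ℕ) × (Fin r → ℤ)))
    (c : (Fin r → ℕ) × (Fin r → ℤ) → MotFun e A) :
    shapeSum L c = ∑ ab ∈ L, MotFun.pull (projA r A) e (c ab) *
      PFun.toMotFunHom e _ (monomialPFun A ab) := by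
  refine Finset.sum_congr rfl fun ab _ => ?_
  rw [monomialPFun, map_mul, map_prod, ← mul_assoc]
  simp only [map_pow]
  rfl

/-- By interpolation, `∑ c_{a,b} g^a 𝕃^{b · g}` is a combination of finitely many of its values,
with Presburger functions as coefficients. -/
theorem shapeSum_eq_zero_of_shapeValue (L : Finset ((Fin r → ℕ) × (Fin r → ℤ)))
    (c : (Fin r → ℕ) × (Fin r → ℤ) → MotFun e A) (h : ∀ j, shapeValue L c j = 0) :
    shapeSum L c = 0 := by
  obtain ⟨N, φ, hφ, hL⟩ := exists_monomialValue_interpolation L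
  let Φ : (Fin r → ℕ) → PFun (vgProd r A) := fun j =>
    ∏ i, ⟨_, expPoly_comp_coord_mem_PFun i (hφ (j i))⟩
  have hΦ : ∀ ab ∈ L, monomialPFun A ab =
      ∑ j ∈ Fintype.piFinset fun _ : Fin r => Finset.range N,
        Φ j * PFun.pull (projA r A) (PFun.const A ⟨_, monomialValue_mem ab j⟩) := by
    intro ab hab
    ext p
    rw [monomialPFun_apply, hL ab hab]
    simp only [AddSubmonoidClass.coe_finsetSum, Finset.sum_apply, Φ]
    refine Finset.sum_congr rfl fun j _ => ?_
    simp only [Subring.coe_mul, SubmonoidClass.coe_finsetProd, Pi.mul_apply, Finset.prod_apply]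
    rfl
  have key : shapeSum L c = ∑ j ∈ Fintype.piFinset fun _ : Fin r => Finset.range N,
      PFun.toMotFunHom e _ (Φ j) * MotFun.pull (projA r A) e (shapeValue L c j) := by
    simp only [shapeSum_eq, shapeValue, map_sum, map_mul, MotFun.pull_toMotFunHom, Finset.mul_sum]
    rw [Finset.sum_comm]
    refine Finset.sum_congr rfl fun ab hab => ?_
    rw [hΦ ab hab, map_sum, Finset.mul_sum]
    refine Finset.sum_congr rfl fun j _ => ?_
    rw [map_mul]
    ring
  rw [key]
  exact Finset.sum_eq_zero fun j _ => by rw [h j, map_zero, mul_zero]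

/-- The map `a ↦ (j, a)` for `j ∈ ℕ^r`, defined on a set of points `A'` and with values in any set
of points `T` that contains its image. -/
def constSection {A' : Set (Point.{u} C V)} {T : Set (Point.{u} C ((ambient 0 0 r).prod V))}
    (j : Fin r → ℕ)
    (h : ∀ p ∈ A', (⟨p.K, (vgPt fun i => (j i : ℤ)).append p.x⟩ : Point.{u} C _) ∈ T) :
    DefMap A' T where
  toFun _ x := (vgPt fun i => (j i : ℤ)).append x
  maps := h
  definable W φ := by
    let ρ : Ren (((ambient 0 0 r).prod V).prod W) ((V.prod W).prod (ambient 0 0 r)) :=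
      ⟨Sum.elim (Sum.elim Sum.inr (Sum.inl ∘ Sum.inl)) (Sum.inl ∘ Sum.inr),
        Sum.elim (Sum.elim Sum.inr (Sum.inl ∘ Sum.inl)) (Sum.inl ∘ Sum.inr),
        Sum.elim (Sum.elim Sum.inr (Sum.inl ∘ Sum.inl)) (Sum.inl ∘ Sum.inr)⟩
    obtain ⟨φ', hφ'⟩ := exists_subst_vg.{u} (fun i => (j i : ℤ)) (φ.rename ρ)
    refine ⟨φ', fun p _ y => ?_⟩
    rw [hφ', Formula.realize_rename]
    refine iff_of_eq (congrArg _ ?_)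
    ext i <;> rcases i with (i | i) | i <;> rfl

/-- The vanishing of a restriction of `∑ c_{a,b} g^a 𝕃^{b · g}` to a set that contains `{j} × A'`
gives the vanishing of its value at `j` over `A'`. -/
theorem shapeValue_eq_zero_of_restrict {A' : Set (Point.{u} C V)} (hA' : A' ⊆ A)
    {T : Set (Point.{u} C ((ambient 0 0 r).prod V))} (hT : T ⊆ vgProd r A)
    (L : Finset ((Fin r → ℕ) × (Fin r → ℤ))) (c : (Fin r → ℕ) × (Fin r → ℤ) → MotFun e A)
    (j : Fin r → ℕ)
    (h : ∀ p ∈ A', (⟨p.K, (vgPt fun i => (j i : ℤ)).append p.x⟩ : Point.{u} C _) ∈ T)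
    (h0 : MotFun.restrict hT (shapeSum L c) = 0) :
    shapeValue L (fun ab => MotFun.restrict hA' (c ab)) j = 0 := by
  rw [← map_zero (MotFun.pull (constSection j h) e), ← h0, shapeSum_eq]
  simp only [MotFun.restrict, MotFun.pull_pull, shapeValue, map_sum, map_mul,
    MotFun.pull_toMotFunHom]
  refine Finset.sum_congr rfl fun ab _ => ?_
  refine congrArg₂ (· * ·) rfl (congrArg _ (Subtype.ext (funext fun p => ?_)))
  let q : vgProd r A := (DefMap.inclusion hT).pt ((constSection j h).pt p)
  exact (monomialPFun_apply ab q).symm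

theorem MotFun.restrict_shapeSum {A' : Set (Point.{u} C V)} (hA' : A' ⊆ A)
    (h : vgProd r A' ⊆ vgProd r A)
    (L : Finset ((Fin r → ℕ) × (Fin r → ℤ))) (c : (Fin r → ℕ) × (Fin r → ℤ) → MotFun e A) :
    MotFun.restrict h (shapeSum L c) = shapeSum L fun ab => MotFun.restrict hA' (c ab) := by
  rw [shapeSum_eq, shapeSum_eq]
  simp only [MotFun.restrict, MotFun.pull_pull, map_sum, map_mul, MotFun.pull_toMotFunHom]
  refine Finset.sum_congr rfl fun ab _ => ?_
  refine congrArg₂ (· * ·) rfl (congrArg _ (Subtype.ext (funext fun p => ?_)))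
  rw [monomialPFun_apply]
  exact monomialPFun_apply ab ((DefMap.inclusion h).pt p)

/-- If the restrictions of `∑ c_{a,b} g^a 𝕃^{b · g}` to the fibres over the points `(K, j)` vanish,
then so do its values over every set of points whose structures are elementarily equivalent
to `K`: as `j` is named by closed terms, all points `(K', j)` with `K' ≡ K` have the same type. -/
theorem shapeValue_eq_zero_of_pointFiber {A' : Set (Point.{u} C V)} (hA' : A' ⊆ A)
    (L : Finset ((Fin r → ℕ) × (Fin r → ℤ))) (c : (Fin r → ℕ) × (Fin r → ℤ) → MotFun e A)
    (K : DPModel.{u} C) (hK : ∀ p ∈ A', ElemEquiv p.K K) (j : Fin r → ℕ)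
    (h0 : MotFun.restrict (pointFiber_subset A ⟨K, vgPt fun i => (j i : ℤ)⟩)
      (shapeSum L c) = 0) :
    shapeValue L (fun ab => MotFun.restrict hA' (c ab)) j = 0 :=
  shapeValue_eq_zero_of_restrict hA' (pointFiber_subset A _) L c j
    (fun p hp => ⟨⟨fun _ => Int.natCast_nonneg _, hA' hp⟩, (hK p hp).sameType_vgPt _⟩) h0

end Vanishing

end Motivic

end

theorem proposition1 {C : Motivic.Sorts.{v}} (S : Set (Motivic.DPModel.{u} C))
    (e : Motivic.Kind) {m n l : ℕ} (A : Set (Motivic.Point.{u} C (Motivic.ambient m n l)))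
    (hA : Motivic.IsDefinable S A) (r : ℕ) (L : Finset ((Fin r → ℕ) × (Fin r → ℤ)))
    (c : (Fin r → ℕ) × (Fin r → ℤ) → Motivic.MotFun e A) :
    ((∀ x : Fin r → ℕ,
        Motivic.MotFun.restrict (Motivic.fiber_subset A x) (Motivic.shapeSum L c) = 0) →
      Motivic.shapeSum L c = 0) ∧
    ((∀ x : Motivic.Point.{u} C (Motivic.ambient 0 0 r), x.K ∈ S → (∀ i, 0 ≤ x.x.vg i) →
        Motivic.MotFun.restrict (Motivic.pointFiber_subset A x) (Motivic.shapeSum L c) = 0) →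
      (∀ K ∈ S, Motivic.MotFun.restrict (Motivic.overStructure_subset r A K)
        (Motivic.shapeSum L c) = 0) ∧
      ((∀ K ∈ S, ∀ K' ∈ S, Motivic.ElemEquiv K K') → Motivic.shapeSum L c = 0)) := by
  refine ⟨fun h => ?_, fun h => ⟨fun K hK => ?_, fun hS => ?_⟩⟩
  · refine Motivic.shapeSum_eq_zero_of_shapeValue L c fun j => ?_
    have := Motivic.shapeValue_eq_zero_of_restrict (subset_refl A)
      (Motivic.fiber_subset A j) L c j
      (fun p hp => ⟨⟨fun i => Int.natCast_nonneg _, hp⟩, fun i => rfl⟩) (h j)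
    simpa only [Motivic.MotFun.restrict_self] using this
  · -- Over the structures equivalent to `K`, pass to the part `A'` of `A` over them.
    let A' : Set (Motivic.Point.{u} C (Motivic.ambient m n l)) :=
      {p | p ∈ A ∧ Motivic.ElemEquiv p.K K}
    have hA' : A' ⊆ A := fun p hp => hp.1
    have h1 : Motivic.vgProd r A' ⊆ Motivic.vgProd r A := fun p hp => ⟨hp.1, hp.2.1⟩
    have h2 : Motivic.overStructure r A K ⊆ Motivic.vgProd r A' :=
      fun p hp => ⟨hp.1.1, hp.1.2, hp.2⟩
    have h3 : Motivic.MotFun.restrict h1 (Motivic.shapeSum L c) = 0 := by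
      rw [Motivic.MotFun.restrict_shapeSum hA']
      exact Motivic.shapeSum_eq_zero_of_shapeValue _ _ fun j =>
        Motivic.shapeValue_eq_zero_of_pointFiber hA' L c K (fun p hp => hp.2) j
          (h _ hK fun i => Int.natCast_nonneg _)
    have h4 := congrArg (Motivic.MotFun.restrict h2) h3
    simp only [Motivic.MotFun.restrict, Motivic.MotFun.pull_pull, map_zero] at h4
    exact h4
  · -- If `A` has no points, there is no structure at hand, and the ring of motivic functions
    -- on `A` is zero.
    refine Motivic.shapeSum_eq_zero_of_shapeValue L c fun j => ?_
    have hAS : ∀ p ∈ A, p.K ∈ S := by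
      obtain ⟨φ, rfl⟩ := hA
      exact fun p hp => hp.1
    rcases A.eq_empty_or_nonempty with rfl | ⟨q, hq⟩
    · have := Motivic.MotFun.subsingleton_of_isEmpty (e := e)
        (B := (∅ : Set (Motivic.Point.{u} C (Motivic.ambient m n l))))
      exact Subsingleton.elim _ _
    · have := Motivic.shapeValue_eq_zero_of_pointFiber (subset_refl A) L c q.K
        (fun p hp => hS _ (hAS p hp) _ (hAS q hq)) j
        (h _ (hAS q hq) fun i => Int.natCast_nonneg _)
      simpa only [Motivic.MotFun.restrict_self] using this
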